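/- Let a finite game be given by a finite set of players, a finite non-empty strategy set $S_i$ for each player $i$, and a utility function $u : Z=\prod_i S_i \to \mathbb{R}^{N}$, where $N$ is the number of players. Let $X=\prod_i \Delta(S_i)$ be the space of mixed profiles, in which each pure profile $q\in Z$ is identified with the corresponding product of point masses, and let $\mathbb{U}(x)=\sum_{q\in Z}u(q)\prod_i x^i_{q_i}$. Let $\phi:X\times\mathbb{R}\to X$ be the replicator flow, i.e. the flow of the replicator equation \[ \dot x^i_s = x^i_s\Bigl(\mathbb{U}_i(s;x_{-i})-\sum_{t\in S_i}x^i_t\,\mathbb{U}_i(t;x_{-i})\Bigr). \] \emph{Chains.} Let $\mathbf d$ be the maximum metric on $X$. For $\epsilon,T>0$, an $(\epsilon,T)$-chain from $x$ to $y$ consists of points $x=x_0,x_1,\dots,x_n=y$ with $n\ge 1$ and times $t_0,\dots,t_{n-1}\ge T$ such that $\mathbf{d}(\phi(x_i,t_i),x_{i+1})<\epsilon$ for all $i<n$. There is a pseudo-orbit from $x$ to $y$ if there is an $(\epsilon,T)$-chain from $x$ to $y$ for all $\epsilon,T>0$. Points $x,y$ are chain equivalent if there are pseudo-orbits in both directions,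 and $x$ is chain recurrent if it is chain equivalent to itself. Chain components are the equivalence classes of chain recurrent points under chain equivalence; a sink chain component is one from which no pseudo-orbit leads to a different chain component. \emph{Response graph.} This is the directed graph on $Z$ with an arc from $p$ to $q$ if and only if, for some player $i$, $p$ and $q$ differ exactly in the strategy of player $i$ and $u_i(p)\le u_i(q)$. A set of nodes is attracting if no path leaves it; a sink connected component is a minimal non-empty attracting set. \textbf{Theorem (Existence of sink chain components).} \begin{enumerate} \item For every chain recurrent $x\in X$ there are a pure profile $y$, a sink connected component $H$ of the response graph with $y\in H$, and a sink chain component $[H]$ with $H\subseteq [H]$, such that there is a pseudo-orbit from $x$ to $y$. \item A sink chain component exists. \item Every sink chain component contains a sink connected component of the response graph. \end{enumerate} -/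

import Mathlib

/-! ### Games, mixed profiles, the replicator vector field -/

section Games

variable {ι : Type*} [Fintype ι] [DecidableEq ι]
  {S : ι → Type*} [∀ i, Fintype (S i)] [∀ i, DecidableEq (S i)]

/-- The strategy space `X`: the product over the players `i` of the simplices of probability
distributions on the strategy sets `S i`, with the product (sup) metric. -/
abbrev StrategySpace {ι : Type*} (S : ι → Type*) [∀ i, Fintype (S i)] : Type _ :=
  ∀ i, stdSimplex ℝ (S i)

/-- The vector of coordinates `x i s` of a mixed profile, in the ambient vector space. -/
def StrategySpace.coords {ι : Type*} {S : ι → Type*} [∀ i, Fintype (S i)]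
    (x : StrategySpace S) : ∀ i, S i → ℝ :=
  fun i s => (x i).1 s

/-- A pure profile regarded as a mixed profile: every player plays a point mass. -/
def pureProfile (q : ∀ i, S i) : StrategySpace S :=
  fun i => ⟨Pi.single (q i) 1, single_mem_stdSimplex ℝ (q i)⟩

/-- The expected utility `∑ q, u q i * ∏ j, x j (q j)` of player `i`. -/
def expectedUtility (u : (∀ i, S i) → ι → ℝ) (x : ∀ i, S i → ℝ) (i : ι) : ℝ :=
  ∑ q : ∀ i, S i, u q i * ∏ j, x j (q j)

/-- The expected utility of player `i` when `i` deviates from `x` to the pure strategy `s`. -/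
def deviationUtility (u : (∀ i, S i) → ι → ℝ) (x : ∀ i, S i → ℝ) (i : ι) (s : S i) : ℝ :=
  expectedUtility u (Function.update x i (Pi.single s 1)) i

/-- The right-hand side of the replicator equation. -/
def replicatorField (u : (∀ i, S i) → ι → ℝ) (x : ∀ i, S i → ℝ) : ∀ i, S i → ℝ :=
  fun i s => x i s * (deviationUtility u x i s - ∑ t, x i t * deviationUtility u x i t)

/-- A flow on the strategy space is a replicator flow if its orbits solve the replicator
equation. -/
def IsReplicatorFlow (u : (∀ i, S i) → ι → ℝ) (φ : Flow ℝ (StrategySpace S)) : Prop :=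
  ∀ x : StrategySpace S,
    IsIntegralCurve (fun t => (φ t x).coords) (fun _ => replicatorField u)

end Games

/-! ### Existence and uniqueness of the replicator flow -/

/-- A bounded Lipschitz vector field has a global flow. -/
theorem exists_globalFlow_of_lipschitz {E : Type*} [NormedAddCommGroup E] [NormedSpace ℝ E]
    [CompleteSpace E] (W : E → E) (K L : NNReal) (hW : LipschitzWith K W)
    (hL : ∀ x, ‖W x‖ ≤ L) :
    ∃ φ : ℝ → E → E, Continuous (Function.uncurry φ) ∧ (∀ x, φ 0 x = x) ∧
      ∀ x t, HasDerivAt (fun r => φ r x) (W (φ t x)) t := by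
  have key : ∀ n : ℕ, ∃ α : E × ℝ → E, (∀ x, ‖x‖ ≤ n + 1 → α (x, 0) = x ∧
      ∀ t ∈ Set.Ioo (-((n : ℝ) + 1)) (n + 1), HasDerivAt (fun r => α (x, r)) (W (α (x, t))) t) ∧
      ContinuousOn α (Metric.closedBall 0 (n + 1) ×ˢ Set.Icc (-((n : ℝ) + 1)) (n + 1)) := by
    intro n
    have h0 : (0 : ℝ) ∈ Set.Icc (-((n : ℝ) + 1)) (n + 1) := by
      constructor <;> linarith [(n.cast_nonneg : (0 : ℝ) ≤ n)]
    have hPL : IsPicardLindelof (fun _ : ℝ => W) (tmin := -((n : ℝ) + 1)) (tmax := n + 1)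
        ⟨0, h0⟩ (0 : E) ((n + 1) + L * (n + 1)) (n + 1) L K := by
      refine ⟨fun _ _ => hW.lipschitzOnWith, fun _ _ => continuousOn_const,
        fun _ _ x _ => hL x, ?_⟩
      simp
    obtain ⟨α, h1, h2⟩ := hPL.exists_forall_mem_closedBall_eq_hasDerivWithinAt_continuousOn
    refine ⟨α, fun x hx => ?_, by simpa using h2⟩
    obtain ⟨h3, h4⟩ := h1 x (by simpa using hx)
    exact ⟨h3, fun t ht => (h4 t (Set.Ioo_subset_Icc_self ht)).hasDerivAt
      (Icc_mem_nhds ht.1 ht.2)⟩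
  choose α hα hαc using key
  have agree : ∀ m n : ℕ, m ≤ n → ∀ x, ‖x‖ ≤ m + 1 → ∀ t ∈ Set.Ioo (-((m : ℝ) + 1)) (m + 1),
      α n (x, t) = α m (x, t) := by
    intro m n hmn x hx t ht
    have hmn' : (m : ℝ) ≤ n := by exact_mod_cast hmn
    have hm0 : (0 : ℝ) ≤ m := m.cast_nonneg
    refine ODE_solution_unique_of_mem_Ioo (v := fun _ => W) (s := fun _ => Set.univ) (t₀ := 0)
      (K := K) (fun _ _ => hW.lipschitzOnWith) ⟨by linarith, by linarith⟩
      (f := fun r => α n (x, r)) (g := fun r => α m (x, r))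
      (fun r hr => ⟨(hα n x (by linarith)).2 r ⟨by linarith [hr.1], by linarith [hr.2]⟩, trivial⟩)
      (fun r hr => ⟨(hα m x hx).2 r hr, trivial⟩) ?_ ht
    rw [(hα n x (by linarith)).1, (hα m x hx).1]
  let N : ℝ → E → ℕ := fun t x => ⌈max |t| ‖x‖⌉₊
  have hN : ∀ t x, |t| < N t x + 1 ∧ ‖x‖ < N t x + 1 := by
    intro t x
    have h := Nat.le_ceil (max |t| ‖x‖)
    have h1 := le_max_left |t| ‖x‖
    have h2 := le_max_right |t| ‖x‖
    constructor <;> simp only [N] <;> linarith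
  have eqn : ∀ (n : ℕ) (t : ℝ) (x : E), |t| < n + 1 → ‖x‖ < n + 1 → α (N t x) (x, t) = α n (x, t) := by
    intro n t x ht hx
    rcases le_total n (N t x) with h | h
    · exact agree n _ h x hx.le t (abs_lt.1 ht)
    · exact (agree _ n h x (hN t x).2.le t (abs_lt.1 (hN t x).1)).symm
  refine ⟨fun t x => α (N t x) (x, t), ?_, ?_, ?_⟩
  · rw [continuous_iff_continuousAt]
    rintro ⟨t, x⟩
    have hopen : IsOpen {p : ℝ × E | |p.1| < (N t x : ℝ) + 1 ∧ ‖p.2‖ < (N t x : ℝ) + 1} :=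
      IsOpen.and (isOpen_lt (by fun_prop) (by fun_prop)) (isOpen_lt (by fun_prop) (by fun_prop))
    have hmem := hopen.mem_nhds (show (t, x) ∈ _ from hN t x)
    have hev : (fun p : ℝ × E => α (N t x) (p.2, p.1)) =ᶠ[nhds (t, x)]
        Function.uncurry fun t x => α (N t x) (x, t) := by
      filter_upwards [hmem] with p hp
      exact (eqn (N t x) p.1 p.2 hp.1 hp.2).symm
    refine ContinuousAt.congr ?_ hev
    have hc : ContinuousOn (fun p : ℝ × E => α (N t x) (p.2, p.1))
        {p : ℝ × E | |p.1| < (N t x : ℝ) + 1 ∧ ‖p.2‖ < (N t x : ℝ) + 1} := by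
      refine (hαc (N t x)).comp (by fun_prop) ?_
      rintro p ⟨hp1, hp2⟩
      exact ⟨by simpa using hp2.le, (abs_le.1 hp1.le)⟩
    exact hc.continuousAt hmem
  · intro x
    exact (hα _ x (hN 0 x).2.le).1
  · intro x t
    have hopen : IsOpen {r : ℝ | |r| < (N t x : ℝ) + 1} := isOpen_lt (by fun_prop) (by fun_prop)
    have hev : (fun r => α (N r x) (x, r)) =ᶠ[nhds t] fun r => α (N t x) (x, r) := by
      filter_upwards [hopen.mem_nhds (show t ∈ _ from (hN t x).1)] with r hr
      exact eqn (N t x) r x hr (hN t x).2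
    exact ((hα (N t x) x (hN t x).2.le).2 t (abs_lt.1 (hN t x).1)).congr_of_eventuallyEq hev

section ReplicatorFlow

set_option linter.unusedSectionVars false

variable {ι : Type*} [Fintype ι] [DecidableEq ι]
  {S : ι → Type*} [∀ i, Fintype (S i)] [∀ i, DecidableEq (S i)]

theorem StrategySpace.continuous_coords :
    Continuous (StrategySpace.coords : StrategySpace S → ∀ i, S i → ℝ) := by
  unfold StrategySpace.coords
  refine continuous_pi fun i => continuous_pi fun s => ?_
  exact (continuous_apply s).comp (continuous_subtype_val.comp (continuous_apply i))

theorem contDiff_coord (i : ι) (s : S i) : ContDiff ℝ 1 (fun x : ∀ i, S i → ℝ => x i s) :=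
  contDiff_pi.1 (contDiff_pi.1 contDiff_id i) s

theorem contDiff_deviationUtility (u : (∀ i, S i) → ι → ℝ) (i : ι) (s : S i) :
    ContDiff ℝ 1 (fun x : ∀ i, S i → ℝ => deviationUtility u x i s) := by
  unfold deviationUtility expectedUtility
  refine ContDiff.sum fun q _ => contDiff_const.mul (contDiff_prod fun j _ => ?_)
  by_cases h : j = i
  · subst h
    simp only [Function.update_self]
    exact contDiff_const
  · simp only [Function.update_of_ne h]
    exact contDiff_coord j (q j)

/-- The growth rate of `s` in the pairwise form of the replicator equation. -/
def pairwiseRate (u : (∀ i, S i) → ι → ℝ) (x : ∀ i, S i → ℝ) (i : ι) (s : S i) : ℝ :=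
  ∑ t, x i t * (deviationUtility u x i s - deviationUtility u x i t)

theorem contDiff_pairwiseRate (u : (∀ i, S i) → ι → ℝ) (i : ι) (s : S i) :
    ContDiff ℝ 1 (fun x : ∀ i, S i → ℝ => pairwiseRate u x i s) := by
  unfold pairwiseRate
  refine ContDiff.sum fun t _ => (contDiff_coord i t).mul ?_
  exact (contDiff_deviationUtility u i s).sub (contDiff_deviationUtility u i t)

/-- Truncation of all coordinates to the interval `[0, 1]`. -/
def clampCoords (x : ∀ i, S i → ℝ) : ∀ i, S i → ℝ := fun i s => max 0 (min 1 (x i s))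

/-- A bounded Lipschitz field on the ambient space that agrees with the replicator field on the
strategy space. -/
def truncatedField (u : (∀ i, S i) → ι → ℝ) (x : ∀ i, S i → ℝ) : ∀ i, S i → ℝ :=
  fun i s => clampCoords x i s * pairwiseRate u (clampCoords x) i s

theorem clamp_lipschitz : LipschitzWith 1 (fun z : ℝ => max 0 (min 1 z)) :=
  (LipschitzWith.id.const_min 1).const_max 0

theorem clampCoords_lipschitz :
    LipschitzWith 1 (clampCoords : (∀ i, S i → ℝ) → ∀ i, S i → ℝ) := by
  refine LipschitzWith.of_dist_le_mul fun x y => ?_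
  simp only [NNReal.coe_one, one_mul]
  refine (dist_pi_le_iff dist_nonneg).2 fun i => (dist_pi_le_iff dist_nonneg).2 fun s => ?_
  have h := clamp_lipschitz.dist_le_mul (x i s) (y i s)
  simp only [NNReal.coe_one, one_mul] at h
  exact h.trans ((dist_le_pi_dist (x i) (y i) s).trans (dist_le_pi_dist x y i))

theorem clampCoords_mem (x : ∀ i, S i → ℝ) : clampCoords x ∈ Set.Icc (0 : ∀ i, S i → ℝ) 1 :=
  ⟨fun _ _ => le_max_left _ _, fun _ _ => max_le zero_le_one (min_le_left _ _)⟩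

theorem clampCoords_eq {x : ∀ i, S i → ℝ} (hx : ∀ i, x i ∈ stdSimplex ℝ (S i)) :
    clampCoords x = x := by
  funext i s
  have h := mem_Icc_of_mem_stdSimplex (hx i) s
  simp [clampCoords, h.1, h.2]

theorem truncatedField_eq (u : (∀ i, S i) → ι → ℝ) {x : ∀ i, S i → ℝ}
    (hx : ∀ i, x i ∈ stdSimplex ℝ (S i)) : truncatedField u x = replicatorField u x := by
  funext i s
  simp only [truncatedField, replicatorField, clampCoords_eq hx, pairwiseRate, mul_sub,
    Finset.sum_sub_distrib, ← Finset.sum_mul, (hx i).2, one_mul]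

theorem truncatedField_lipschitz_bounded (u : (∀ i, S i) → ι → ℝ) :
    ∃ K L : NNReal, LipschitzWith K (truncatedField u) ∧ ∀ x, ‖truncatedField u x‖ ≤ L := by
  let F : (∀ i, S i → ℝ) → ∀ i, S i → ℝ := fun x i s => x i s * pairwiseRate u x i s
  have hF : ContDiff ℝ 1 F := by
    refine contDiff_pi.2 fun i => contDiff_pi.2 fun s => (contDiff_coord i s).mul ?_
    exact contDiff_pairwiseRate u i s
  have hc : IsCompact (Set.Icc (0 : ∀ i, S i → ℝ) 1) := isCompact_Icc
  obtain ⟨K, hK⟩ := hF.contDiffOn.exists_lipschitzOnWith one_ne_zero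
    (convex_Icc (0 : ∀ i, S i → ℝ) 1) hc
  obtain ⟨L, hL⟩ := hc.exists_bound_of_continuousOn hF.continuous.continuousOn
  refine ⟨K, L.toNNReal, ?_, fun x => ?_⟩
  · have h := hK.comp (clampCoords_lipschitz (S := S)).lipschitzOnWith
      (s := Set.univ) (fun x _ => clampCoords_mem x)
    rw [mul_one, lipschitzOnWith_univ] at h
    exact h
  · exact (hL _ (clampCoords_mem x)).trans (Real.le_coe_toNNReal L)

/-- The strategy space is invariant under the truncated field. -/
theorem mem_simplex_of_truncated (u : (∀ i, S i) → ι → ℝ) (f : ℝ → ∀ i, S i → ℝ)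
    (hf : ∀ t, HasDerivAt f (truncatedField u (f t)) t)
    (h0 : ∀ i, f 0 i ∈ stdSimplex ℝ (S i)) (t : ℝ) (i : ι) : f t i ∈ stdSimplex ℝ (S i) := by
  have hcoord : ∀ i s t, HasDerivAt (fun r => f r i s) (truncatedField u (f t) i s) t :=
    fun i s t => hasDerivAt_pi.1 (hasDerivAt_pi.1 (hf t) i) s
  constructor
  · intro s
    by_contra! hneg
    have hcont : Continuous fun r => f r i s :=
      continuous_iff_continuousAt.2 fun r => (hcoord i s r).continuousAt
    obtain ⟨t₂, ht₂⟩ : ∃ t₂, f t₂ i s = 0 :=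
      mem_range_of_exists_le_of_exists_ge hcont ⟨t, hneg.le⟩ ⟨0, (h0 i).1 s⟩
    obtain ⟨G, hG⟩ := (isCompact_Icc (a := (0 : ∀ i, S i → ℝ)) (b := 1)).exists_bound_of_continuousOn
      (contDiff_pairwiseRate u i s).continuous.continuousOn
    let v : ℝ → ℝ → ℝ := fun r z => max 0 (min 1 z) * pairwiseRate u (clampCoords (f r)) i s
    have hv : ∀ r, LipschitzOnWith G.toNNReal (v r) Set.univ := by
      intro r
      refine LipschitzOnWith.of_dist_le_mul fun a _ b _ => ?_
      have h1 := clamp_lipschitz.dist_le_mul a b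
      have h2 := hG _ (clampCoords_mem (f r))
      simp only [NNReal.coe_one, one_mul, Real.dist_eq] at h1
      rw [Real.dist_eq, Real.dist_eq, ← sub_mul, abs_mul, mul_comm]
      exact mul_le_mul (h2.trans (Real.le_coe_toNNReal G)) h1 (abs_nonneg _) (NNReal.coe_nonneg _)
    have huniq : (fun r => f r i s) = fun _ => 0 := by
      refine ODE_solution_unique_univ (v := v) (s := fun _ => Set.univ) (t₀ := t₂) hv
        (fun r => ⟨hcoord i s r, trivial⟩) (fun r => ⟨?_, trivial⟩) ht₂
      simpa [v] using hasDerivAt_const r (0 : ℝ)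
    have h := congrFun huniq t
    exact hneg.ne h
  · have hsum : ∀ r, HasDerivAt (fun r => ∑ s, f r i s) 0 r := by
      intro r
      have h := HasDerivAt.fun_sum (u := Finset.univ) fun s _ => hcoord i s r
      have hz : ∑ s, truncatedField u (f r) i s = 0 := by
        simp only [truncatedField, pairwiseRate, mul_sub, Finset.sum_sub_distrib, Finset.mul_sum]
        rw [sub_eq_zero, Finset.sum_comm]
        exact Finset.sum_congr rfl fun a _ => Finset.sum_congr rfl fun b _ => by ring
      rw [hz] at h
      exact h
    have hconst := is_const_of_deriv_eq_zero (fun r => (hsum r).differentiableAt)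
      (fun r => (hsum r).deriv) t 0
    exact hconst.trans (h0 i).2

/-- The replicator equation has a flow on the strategy space. -/
theorem exists_isReplicatorFlow (u : (∀ i, S i) → ι → ℝ) :
    ∃ φ : Flow ℝ (StrategySpace S), IsReplicatorFlow u φ := by
  obtain ⟨K, L, hK, hL⟩ := truncatedField_lipschitz_bounded u
  obtain ⟨φ, hc, h0, hd⟩ := exists_globalFlow_of_lipschitz (truncatedField u) K L hK hL
  have hmem : ∀ (t : ℝ) (x : StrategySpace S) (i : ι),
      φ t x.coords i ∈ stdSimplex ℝ (S i) := fun t x i =>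
    mem_simplex_of_truncated u (fun r => φ r x.coords) (hd x.coords)
      (fun j => by simp only [h0]; exact (x j).2) t i
  have hadd : ∀ s t x, φ (s + t) x = φ s (φ t x) := by
    intro s t x
    have := ODE_solution_unique_univ (v := fun _ => truncatedField u) (s := fun _ => Set.univ)
      (K := K) (t₀ := 0) (f := fun r => φ (r + t) x) (g := fun r => φ r (φ t x))
      (fun _ => hK.lipschitzOnWith) (fun r => ⟨(hd x (r + t)).comp_add_const r t, trivial⟩)
      (fun r => ⟨hd _ r, trivial⟩) (by simp only [zero_add, h0])
    exact congrFun this s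
  refine ⟨⟨fun t x i => ⟨φ t x.coords i, hmem t x i⟩, ?_, ?_, ?_⟩, ?_⟩
  · refine continuous_pi fun i => Continuous.subtype_mk ?_ _
    exact (continuous_apply i).comp
      (hc.comp (continuous_fst.prodMk (StrategySpace.continuous_coords.comp continuous_snd)))
  · intro s t x
    funext i
    exact Subtype.ext (congrFun (hadd s t x.coords) i)
  · intro x
    funext i
    exact Subtype.ext (congrFun (h0 x.coords) i)
  · intro x t
    have h := hd x.coords t
    rw [truncatedField_eq u (hmem t x)] at h
    exact h

/-- There is only one replicator flow, so `replicatorFlow` below does not depend on a choice. -/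
theorem IsReplicatorFlow.unique (u : (∀ i, S i) → ι → ℝ) {φ ψ : Flow ℝ (StrategySpace S)}
    (hφ : IsReplicatorFlow u φ) (hψ : IsReplicatorFlow u ψ) (t : ℝ) (x : StrategySpace S) :
    φ t x = ψ t x := by
  obtain ⟨K, L, hK, -⟩ := truncatedField_lipschitz_bounded u
  have aux : ∀ χ : Flow ℝ (StrategySpace S), IsReplicatorFlow u χ → ∀ r,
      HasDerivAt (fun t => (χ t x).coords) (truncatedField u (χ r x).coords) r := by
    intro χ hχ r
    have hmem : ∀ i, (χ r x).coords i ∈ stdSimplex ℝ (S i) := fun i => (χ r x i).2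
    rw [truncatedField_eq u hmem]
    exact hχ x r
  have h := ODE_solution_unique_univ (v := fun _ => truncatedField u) (s := fun _ => Set.univ)
    (K := K) (t₀ := 0) (fun _ => hK.lipschitzOnWith) (fun r => ⟨aux φ hφ r, trivial⟩)
    (fun r => ⟨aux ψ hψ r, trivial⟩) (by simp only [Flow.map_zero_apply])
  funext i
  exact Subtype.ext (congrFun (congrFun h t) i)

/-- The replicator flow of the game with utility function `u`. -/
noncomputable def replicatorFlow (u : (∀ i, S i) → ι → ℝ) : Flow ℝ (StrategySpace S) :=
  (exists_isReplicatorFlow u).choose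

theorem replicatorFlow_spec (u : (∀ i, S i) → ι → ℝ) : IsReplicatorFlow u (replicatorFlow u) :=
  (exists_isReplicatorFlow u).choose_spec

end ReplicatorFlow

/-! ### The response graph -/

section ResponseGraph

variable {ι : Type*} {S : ι → Type*}

/-- The response graph: there is an arc from `p` to `q` if they differ exactly in the strategy of
one player `i`, and `i` weakly prefers `q`. -/
def responseGraph (u : (∀ i, S i) → ι → ℝ) : Digraph (∀ i, S i) where
  Adj p q := ∃ i, p i ≠ q i ∧ (∀ j, j ≠ i → p j = q j) ∧ u p i ≤ u q i

/-- A set of nodes of a directed graph is attracting if no path leaves it. -/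
def Digraph.IsAttracting {V : Type*} (G : Digraph V) (W : Set V) : Prop :=
  ∀ p ∈ W, ∀ q, Relation.ReflTransGen G.Adj p q → q ∈ W

/-- The sink connected components are the minimal nonempty attracting sets of nodes. -/
def Digraph.IsSinkConnectedComponent {V : Type*} (G : Digraph V) (H : Set V) : Prop :=
  Minimal (fun W : Set V => W.Nonempty ∧ G.IsAttracting W) H

end ResponseGraph

/-! ### Chains -/

section Chains

variable {α : Type*} [MetricSpace α] (φ : Flow ℝ α)

/-- There is an `(ε, T)`-chain from `x` to `y`, with `n ≥ 1` steps. -/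
def HasChain (ε T : ℝ) (x y : α) : Prop :=
  ∃ n : ℕ, 1 ≤ n ∧ ∃ (z : ℕ → α) (t : ℕ → ℝ), z 0 = x ∧ z n = y ∧
    ∀ i < n, T ≤ t i ∧ dist (φ (t i) (z i)) (z (i + 1)) < ε

/-- There is a pseudo-orbit from `x` to `y`. -/
def HasPseudoOrbit (x y : α) : Prop :=
  ∀ ε > 0, ∀ T > 0, HasChain φ ε T x y

/-- Chain equivalence. -/
def ChainEquivalent (x y : α) : Prop :=
  HasPseudoOrbit φ x y ∧ HasPseudoOrbit φ y x

/-- Chain recurrence. -/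
def IsChainRecurrent (x : α) : Prop :=
  ChainEquivalent φ x x

/-- The chain components are the classes of chain recurrent points under chain equivalence. -/
def IsChainComponent (C : Set α) : Prop :=
  ∃ x, IsChainRecurrent φ x ∧ C = {y | ChainEquivalent φ x y}

/-- A sink chain component is a chain component that is minimal in the order given by
pseudo-orbits: no pseudo-orbit leads from it to another chain component. -/
def IsSinkChainComponent (C : Set α) : Prop :=
  IsChainComponent φ C ∧
    ∀ D, IsChainComponent φ D → (∃ x ∈ C, ∃ y ∈ D, HasPseudoOrbit φ x y) → D = C

end Chains

/-! ### Chains and pseudo-orbits -/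

section ChainLemmas

variable {α : Type*} [MetricSpace α] {φ : Flow ℝ α} {ε T : ℝ} {x y z : α}

/-! The heart is that every mixed profile `x` has a pseudo-orbit to a pure profile
(`exists_pureProfile_hasPseudoOrbit`). Fix `ε`, `T` and let `R` be the open set of ends of chains
from `x`. A jump of size less than `ε` from the time-`T` image of a point of `closure R` lands in
`R`. Take `z` of minimal support in `closure R`. If `z` is not pure, minimality and compactness keep
the part of `closure R` in the face of `z` away from the boundary of that face, so it is bounded in
logarithmic coordinates.

In these coordinates the replicator flow preserves volume, because a player's payoff differences do
not depend on that player's own mixture. Instead of differentiating a volume, the proof approximates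
the time-`T` map by moves of one player at a time (`exists_splitStep_approx`). Each move is an exact
shear (`measurePreserving_logStep`). The resulting measure preserving map sends a bounded open set
into itself and leaves room for a further shift by a fixed `δ` in one coordinate. Hence its image
misses a top layer of positive volume, which is absurd. So `z` is pure and at rest, and a chain
reaches it; finiteness of the set of pure profiles turns chains into a pseudo-orbit.

Arcs of the response graph are pseudo-orbits too (`hasPseudoOrbit_update`): along an edge the flow
never works against the better reply, and small jumps do the rest. The remainder is finite
combinatorics. Among pure profiles ordered by pseudo-orbits a terminal class is reachable. Any
pseudo-orbit leaving it can be continued to a pure profile, hence reversed, so its chain component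
is a sink; following responses inside it ends in a sink connected component. -/

theorem hasChain_iff_transGen :
    HasChain φ ε T x y ↔ Relation.TransGen (fun a b => ∃ t, T ≤ t ∧ dist (φ t a) b < ε) x y := by
  constructor
  · rintro ⟨n, hn, z, t, h0, h1, h⟩
    obtain ⟨m, rfl⟩ := Nat.exists_eq_add_of_le' hn
    have key : ∀ k ≤ m,
        Relation.TransGen (fun a b => ∃ t, T ≤ t ∧ dist (φ t a) b < ε) (z 0) (z (k + 1)) := by
      intro k
      induction k with
      | zero => exact fun _ => .single ⟨_, h 0 (by omega)⟩
      | succ k ih => exact fun hk => (ih (by omega)).tail ⟨_, h (k + 1) (by omega)⟩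
    simpa only [h0, h1] using key m le_rfl
  · intro h
    induction h with
    | single h =>
      obtain ⟨t, ht⟩ := h
      refine ⟨1, le_rfl, fun k => if k = 0 then x else _, fun _ => t, rfl, rfl, fun i hi => ?_⟩
      obtain rfl : i = 0 := by omega
      simpa using ht
    | @tail b c _ h ih =>
      obtain ⟨t, ht⟩ := h
      obtain ⟨n, hn, w, τ, h0, h1, hw⟩ := ih
      refine ⟨n + 1, by omega, fun k => if k ≤ n then w k else c,
        fun k => if k < n then τ k else t, by simpa using h0, by simp, fun i hi => ?_⟩
      rcases Nat.lt_or_ge i n with hin | hin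
      · simpa [hin, hin.le, Nat.succ_le_of_lt hin] using hw i hin
      · obtain rfl : i = n := by omega
        simpa [h1] using ht

theorem HasChain.trans (h : HasChain φ ε T x y) (h' : HasChain φ ε T y z) :
    HasChain φ ε T x z :=
  hasChain_iff_transGen.2 ((hasChain_iff_transGen.1 h).trans (hasChain_iff_transGen.1 h'))

theorem HasChain.single {t : ℝ} (ht : T ≤ t) (h : dist (φ t x) y < ε) : HasChain φ ε T x y :=
  hasChain_iff_transGen.2 (.single ⟨t, ht, h⟩)

theorem HasChain.mono {ε' T' : ℝ} (h : HasChain φ ε T x y) (hε : ε ≤ ε') (hT : T' ≤ T) :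
    HasChain φ ε' T' x y := by
  obtain ⟨n, hn, w, τ, h0, h1, hw⟩ := h
  exact ⟨n, hn, w, τ, h0, h1, fun i hi => ⟨hT.trans (hw i hi).1, (hw i hi).2.trans_le hε⟩⟩

theorem HasPseudoOrbit.trans (h : HasPseudoOrbit φ x y) (h' : HasPseudoOrbit φ y z) :
    HasPseudoOrbit φ x z :=
  fun ε hε T hT => (h ε hε T hT).trans (h' ε hε T hT)

theorem HasPseudoOrbit.of_fixed (h : ∀ t, φ t x = x) : HasPseudoOrbit φ x x :=
  fun ε hε T _ => .single le_rfl (by rw [h, dist_self]; exact hε)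

theorem ChainEquivalent.symm (h : ChainEquivalent φ x y) : ChainEquivalent φ y x := ⟨h.2, h.1⟩

theorem ChainEquivalent.trans (h : ChainEquivalent φ x y) (h' : ChainEquivalent φ y z) :
    ChainEquivalent φ x z := ⟨h.1.trans h'.1, h'.2.trans h.2⟩

theorem IsChainComponent.eq_of_mem {C : Set α} (hC : IsChainComponent φ C) (hx : x ∈ C) :
    IsChainRecurrent φ x ∧ C = {y | ChainEquivalent φ x y} := by
  obtain ⟨a, -, rfl⟩ := hC
  exact ⟨hx.symm.trans hx, Set.ext fun y => ⟨hx.symm.trans, hx.trans⟩⟩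

/-- If every point has chains of every quality to a finite set, it has a pseudo-orbit to a member
of that set. -/
theorem exists_hasPseudoOrbit_of_finite {β : Type*} [Finite β] (f : β → α)
    (h : ∀ ε > 0, ∀ T > 0, ∃ b, HasChain φ ε T x (f b)) : ∃ b, HasPseudoOrbit φ x (f b) := by
  have h1 : ∀ n : ℕ, ∃ b, HasChain φ (1 / ((n : ℝ) + 1)) (n + 1) x (f b) := fun n =>
    h _ Nat.one_div_pos_of_nat _ n.cast_add_one_pos
  choose g hg using h1
  -- Pigeonhole: one endpoint serves infinitely many of the qualities `(1/(n+1), n+1)`, hence all of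
  -- them by monotonicity.
  obtain ⟨b, hb⟩ := Finite.exists_infinite_fiber g
  refine ⟨b, fun ε hε T _ => ?_⟩
  obtain ⟨N, hN⟩ := exists_nat_one_div_lt hε
  obtain ⟨n, hn, hle⟩ := (Set.infinite_coe_iff.1 hb).exists_gt (max N ⌈T⌉₊)
  have hn' : g n = b := hn
  have h2 : (N : ℝ) ≤ n := by exact_mod_cast (le_max_left _ _).trans hle.le
  have h3 : (⌈T⌉₊ : ℝ) ≤ n := by exact_mod_cast (le_max_right _ _).trans hle.le
  rw [← hn']
  refine (hg n).mono (le_trans ?_ hN.le) ((Nat.le_ceil T).trans (by linarith))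
  exact one_div_le_one_div_of_le N.cast_add_one_pos (by linarith)

end ChainLemmas

/-! ### Exponential tilting of mixed profiles -/

section Tilt

variable {ι : Type*} {S : ι → Type*} [∀ i, Fintype (S i)]

theorem StrategySpace.coords_nonneg (x : StrategySpace S) (i : ι) (s : S i) : 0 ≤ x.coords i s :=
  (x i).2.1 s

theorem StrategySpace.sum_coords (x : StrategySpace S) (i : ι) : ∑ s, x.coords i s = 1 :=
  (x i).2.2

theorem StrategySpace.coords_le_one (x : StrategySpace S) (i : ι) (s : S i) : x.coords i s ≤ 1 :=
  (mem_Icc_of_mem_stdSimplex (x i).2 s).2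

theorem StrategySpace.ext_coords {x y : StrategySpace S} (h : ∀ i s, x.coords i s = y.coords i s) :
    x = y :=
  funext fun i => Subtype.ext (funext (h i))

theorem StrategySpace.dist_coords [Fintype ι] (x y : StrategySpace S) :
    dist x.coords y.coords = dist x y :=
  rfl

theorem StrategySpace.exists_coords_pos (x : StrategySpace S) (i : ι) : ∃ s, 0 < x.coords i s := by
  by_contra! h
  have := Finset.sum_nonpos fun s (_ : s ∈ Finset.univ) => h s
  rw [x.sum_coords i] at this
  linarith

/-- The normalising factor in the exponential tilting of a mixed profile. -/
noncomputable def partition (x : StrategySpace S) (g : ∀ i, S i → ℝ) (i : ι) : ℝ :=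
  ∑ t, x.coords i t * Real.exp (g i t)

theorem partition_pos (x : StrategySpace S) (g : ∀ i, S i → ℝ) (i : ι) : 0 < partition x g i := by
  obtain ⟨s, hs⟩ := x.exists_coords_pos i
  exact Finset.sum_pos' (fun t _ => mul_nonneg (x.coords_nonneg i t) (Real.exp_pos _).le)
    ⟨s, Finset.mem_univ s, mul_pos hs (Real.exp_pos _)⟩

/-- The mixed profile in which the weight `x i s` is multiplied by `exp (g i s)` and the weights
are normalised again. -/
noncomputable def tilt (x : StrategySpace S) (g : ∀ i, S i → ℝ) : StrategySpace S :=
  fun i => ⟨fun s => x.coords i s * Real.exp (g i s) / partition x g i,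
    fun s => div_nonneg (mul_nonneg (x.coords_nonneg i s) (Real.exp_pos _).le)
      (partition_pos x g i).le,
    by rw [← Finset.sum_div]; exact div_self (partition_pos x g i).ne'⟩

theorem tilt_coords (x : StrategySpace S) (g : ∀ i, S i → ℝ) (i : ι) (s : S i) :
    (tilt x g).coords i s = x.coords i s * Real.exp (g i s) / partition x g i :=
  rfl

theorem tilt_coords_eq_zero {x : StrategySpace S} {g : ∀ i, S i → ℝ} {i : ι} {s : S i} :
    (tilt x g).coords i s = 0 ↔ x.coords i s = 0 := by
  simp [tilt_coords, (partition_pos x g i).ne', Real.exp_ne_zero]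

/-- Normalisation cancels a constant added to all exponents of one player, and exponents off the
support have no effect. This freedom allows a base strategy to be held fixed later. -/
theorem tilt_congr {x : StrategySpace S} {g g' : ∀ i, S i → ℝ} {i : ι} (c : ℝ)
    (h : ∀ s, x.coords i s ≠ 0 → g' i s = g i s + c) : tilt x g' i = tilt x g i := by
  have key : ∀ s, x.coords i s * Real.exp (g' i s) =
      x.coords i s * Real.exp (g i s) * Real.exp c := by
    intro s
    by_cases hs : x.coords i s = 0
    · simp [hs]
    · rw [h s hs, Real.exp_add, mul_assoc]
  have hp : partition x g' i = partition x g i * Real.exp c := by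
    simp only [partition, key, Finset.sum_mul]
  refine Subtype.ext (funext fun s => ?_)
  change x.coords i s * Real.exp (g' i s) / partition x g' i =
    x.coords i s * Real.exp (g i s) / partition x g i
  rw [key, hp, mul_div_mul_right _ _ (Real.exp_ne_zero c)]

theorem tilt_const {x : StrategySpace S} {g : ∀ i, S i → ℝ} {i : ι} (c : ℝ)
    (h : ∀ s, x.coords i s ≠ 0 → g i s = c) : tilt x g i = x i := by
  rw [tilt_congr (g := 0) c (by simpa using h)]
  refine Subtype.ext (funext fun s => ?_)
  change x.coords i s * Real.exp 0 / partition x 0 i = x.coords i s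
  simp [partition, x.sum_coords]

theorem tilt_zero (x : StrategySpace S) : tilt x 0 = x :=
  funext fun _ => tilt_const 0 fun _ _ => rfl

/-- Tilting is an action of the additive group of exponents, so adaptation becomes translation in
logarithmic coordinates. -/
theorem tilt_tilt (x : StrategySpace S) (g g' : ∀ i, S i → ℝ) :
    tilt (tilt x g) g' = tilt x (g + g') := by
  have hp : ∀ i, partition (tilt x g) g' i = partition x (g + g') i / partition x g i := by
    intro i
    simp only [partition, tilt_coords, Finset.sum_div, Pi.add_apply, Real.exp_add]
    exact Finset.sum_congr rfl fun s _ => by ring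
  refine StrategySpace.ext_coords fun i s => ?_
  have h1 := (partition_pos x g i).ne'
  have h2 := (partition_pos x (g + g') i).ne'
  simp only [tilt_coords, hp, Pi.add_apply, Real.exp_add]
  field_simp

theorem tilt_update_of_ne {ι : Type*} [DecidableEq ι] {S : ι → Type*} [∀ i, Fintype (S i)]
    (z : StrategySpace S) (y : ∀ i, S i → ℝ) {i j : ι} (hj : j ≠ i)
    (v : S i → ℝ) : tilt z (Function.update y i v) j = tilt z y j :=
  tilt_congr 0 fun s _ => by simp [hj]

theorem continuous_tilt :
    Continuous (fun p : StrategySpace S × (∀ i, S i → ℝ) => tilt p.1 p.2) := by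
  have hx : ∀ i s, Continuous fun p : StrategySpace S × (∀ i, S i → ℝ) => p.1.coords i s :=
    fun i s => (continuous_apply s).comp
      (continuous_subtype_val.comp ((continuous_apply i).comp continuous_fst))
  have hg : ∀ i s, Continuous fun p : StrategySpace S × (∀ i, S i → ℝ) => p.2 i s :=
    fun i s => (continuous_apply s).comp ((continuous_apply i).comp continuous_snd)
  refine continuous_pi fun i => Continuous.subtype_mk (continuous_pi fun s => ?_) _
  refine ((hx i s).mul (hg i s).rexp).div ?_ fun p => (partition_pos p.1 p.2 i).ne'
  exact continuous_finsetSum _ fun t _ => (hx i t).mul (hg i t).rexp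

end Tilt

/-! ### Explicit solutions of the replicator equation in which only one player moves -/

section Explicit

variable {ι : Type*} [Fintype ι] [DecidableEq ι]
  {S : ι → Type*} [∀ i, Fintype (S i)] [∀ i, DecidableEq (S i)]


/-- The truncated field is used because it is bounded and Lipschitz on the whole ambient space, as
the ODE estimates require. -/
theorem replicatorFlow_hasDerivAt (u : (∀ i, S i) → ι → ℝ) (x : StrategySpace S) (t : ℝ) :
    HasDerivAt (fun r => (replicatorFlow u r x).coords)
      (truncatedField u (replicatorFlow u t x).coords) t := by
  have hmem : ∀ i, (replicatorFlow u t x).coords i ∈ stdSimplex ℝ (S i) :=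
    fun i => (replicatorFlow u t x i).2
  rw [truncatedField_eq u hmem]
  exact replicatorFlow_spec u x t

theorem replicatorFlow_eq_of_isIntegralCurve (u : (∀ i, S i) → ι → ℝ) (γ : ℝ → StrategySpace S)
    (h : ∀ t, HasDerivAt (fun r => (γ r).coords) (replicatorField u (γ t).coords) t) (t : ℝ) :
    replicatorFlow u t (γ 0) = γ t := by
  obtain ⟨K, L, hK, -⟩ := truncatedField_lipschitz_bounded u
  have h' : ∀ r, HasDerivAt (fun r => (γ r).coords) (truncatedField u (γ r).coords) r := by
    intro r
    have hmem : ∀ i, (γ r).coords i ∈ stdSimplex ℝ (S i) := fun i => (γ r i).2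
    rw [truncatedField_eq u hmem]
    exact h r
  have key := ODE_solution_unique_univ (v := fun _ => truncatedField u) (s := fun _ => Set.univ)
    (K := K) (t₀ := 0) (fun _ => hK.lipschitzOnWith)
    (fun r => ⟨replicatorFlow_hasDerivAt u (γ 0) r, trivial⟩) (fun r => ⟨h' r, trivial⟩)
    (by simp only [Flow.map_zero_apply])
  exact StrategySpace.ext_coords fun i s => congrFun (congrFun (congrFun key t) i) s

/-- A deviation overwrites the player's own mixture. This independence is the source of volume
preservation and of the explicit solutions. -/
theorem deviationUtility_congr (u : (∀ i, S i) → ι → ℝ) {x y : ∀ i, S i → ℝ} {i : ι}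
    (h : ∀ j, j ≠ i → x j = y j) (s : S i) :
    deviationUtility u x i s = deviationUtility u y i s := by
  unfold deviationUtility
  congr 1
  funext j
  by_cases hj : j = i
  · subst hj; simp
  · simp [hj, h j hj]

/-- The profile reached from `x` after time `t` if only player `i` adapts. -/
noncomputable def playerStep (u : (∀ i, S i) → ι → ℝ) (i : ι) (t : ℝ) (x : StrategySpace S) :
    StrategySpace S :=
  tilt x (Pi.single i fun s => t * deviationUtility u x.coords i s)

theorem playerStep_of_ne (u : (∀ i, S i) → ι → ℝ) {i j : ι} (hj : j ≠ i) (t : ℝ)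
    (x : StrategySpace S) : playerStep u i t x j = x j :=
  tilt_const 0 fun s _ => by simp [hj]

theorem playerStep_hasDerivAt (u : (∀ i, S i) → ι → ℝ) (i : ι) (x : StrategySpace S) (t : ℝ)
    (s : S i) :
    HasDerivAt (fun r => (playerStep u i r x).coords i s)
      (replicatorField u (playerStep u i t x).coords i s) t := by
  have hdev : ∀ a, deviationUtility u (playerStep u i t x).coords i a =
      deviationUtility u x.coords i a := fun a => deviationUtility_congr u
    (fun j hj => congrArg Subtype.val (playerStep_of_ne u hj t x)) a
  simp only [replicatorField, hdev]
  set d := fun a => deviationUtility u x.coords i a with hd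
  let w : S i → ℝ → ℝ := fun a r => x.coords i a * Real.exp (r * d a)
  have hw : ∀ a r, HasDerivAt (w a) (w a r * d a) r := by
    intro a r
    have := (((hasDerivAt_id r).mul_const (d a)).exp).const_mul (x.coords i a)
    refine this.congr_deriv ?_
    simp only [w, id]
    ring
  have hcoord : ∀ r a, (playerStep u i r x).coords i a = w a r / ∑ b, w b r := by
    intro r a
    simp [playerStep, tilt_coords, partition, w, hd]
  have hpos : 0 < ∑ b, w b t := by
    have := partition_pos x (Pi.single i fun s => t * d s) i
    simpa [partition, w] using this
  have hsum : HasDerivAt (fun r => ∑ b, w b r) (∑ b, w b t * d b) t :=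
    HasDerivAt.fun_sum fun b _ => hw b t
  simp only [hcoord]
  refine HasDerivAt.congr_deriv ((hw s t).fun_div hsum hpos.ne') ?_
  have h2 : ∑ a, w a t / (∑ b, w b t) * deviationUtility u x.coords i a =
      (∑ a, w a t * d a) / ∑ b, w b t := by
    rw [Finset.sum_div]
    exact Finset.sum_congr rfl fun a _ => by simp only [hd]; ring
  rw [h2]
  have h3 := hpos.ne'
  simp only [hd]
  field_simp

/-- If the other players are at rest along the path, the flow moves player `i` only. -/
theorem replicatorFlow_eq_playerStep (u : (∀ i, S i) → ι → ℝ) (i : ι) (x : StrategySpace S)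
    (h : ∀ t, ∀ j, j ≠ i → ∀ s, replicatorField u (playerStep u i t x).coords j s = 0) (t : ℝ) :
    replicatorFlow u t x = playerStep u i t x := by
  have h0 : playerStep u i 0 x = x := by
    unfold playerStep
    simp only [zero_mul]
    convert tilt_zero x
    exact Pi.single_zero i
  have := replicatorFlow_eq_of_isIntegralCurve u (fun r => playerStep u i r x) (fun r => ?_) t
  · rwa [h0] at this
  refine hasDerivAt_pi.2 fun j => hasDerivAt_pi.2 fun s => ?_
  by_cases hj : j = i
  · subst hj
    exact playerStep_hasDerivAt u j x r s
  · rw [h r j hj s]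
    have hc : (fun r => (playerStep u i r x).coords j s) = fun _ => x.coords j s :=
      funext fun r => congrFun (congrArg Subtype.val (playerStep_of_ne u hj r x)) s
    rw [hc]
    exact hasDerivAt_const r _

theorem replicatorField_eq_zero_of_pure (u : (∀ i, S i) → ι → ℝ) {x : ∀ i, S i → ℝ} {j : ι}
    {a : S j} (h : x j = Pi.single a 1) (s : S j) : replicatorField u x j s = 0 := by
  unfold replicatorField
  by_cases hs : s = a
  · subst hs
    simp [h, Pi.single_apply]
  · simp [h, hs]

/-- The game in which all players but `i` are indifferent. -/
def maskUtility (u : (∀ i, S i) → ι → ℝ) (i : ι) : (∀ i, S i) → ι → ℝ :=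
  fun q j => if j = i then u q j else 0

theorem deviationUtility_maskUtility (u : (∀ i, S i) → ι → ℝ) (i j : ι) (x : ∀ i, S i → ℝ)
    (s : S j) : deviationUtility (maskUtility u i) x j s =
      if j = i then deviationUtility u x j s else 0 := by
  unfold deviationUtility expectedUtility maskUtility
  split_ifs <;> simp

/-- Indifferent players stand still. Exhibiting a single-player move as a replicator flow makes the
general error estimates available for it. -/
theorem replicatorFlow_maskUtility (u : (∀ i, S i) → ι → ℝ) (i : ι) (x : StrategySpace S) (t : ℝ) :
    replicatorFlow (maskUtility u i) t x = playerStep u i t x := by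
  rw [replicatorFlow_eq_playerStep (maskUtility u i) i x]
  · simp [playerStep, deviationUtility_maskUtility]
  · intro t j hj s
    simp [replicatorField, deviationUtility_maskUtility, hj]

theorem sum_truncatedField_maskUtility (u : (∀ i, S i) → ι → ℝ) (x : ∀ i, S i → ℝ) :
    ∑ i, truncatedField (maskUtility u i) x = truncatedField u x := by
  funext j s
  rw [Finset.sum_apply, Finset.sum_apply, Finset.sum_eq_single j]
  · simp [truncatedField, pairwiseRate, deviationUtility_maskUtility]
  · intro i _ hi
    simp [truncatedField, pairwiseRate, deviationUtility_maskUtility, hi.symm]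
  · simp

theorem replicatorFlow_pureProfile (u : (∀ i, S i) → ι → ℝ) (q : ∀ i, S i) (t : ℝ) :
    replicatorFlow u t (pureProfile q) = pureProfile q := by
  refine replicatorFlow_eq_of_isIntegralCurve u (fun _ => pureProfile q) (fun r => ?_) t
  have : replicatorField u (pureProfile q).coords = 0 := by
    funext j s
    exact replicatorField_eq_zero_of_pure u rfl s
  rw [this]
  exact hasDerivAt_const _ _

end Explicit

/-! ### Approximation of the replicator flow by moving one player at a time -/

section Splitting

/-- Mean value inequality twice: speed at most `L` gives the first bound, whence the velocity drifts
by at most `K * L * h`, which gives the second. -/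
theorem norm_sub_sub_smul_le_of_hasDerivAt {E : Type*} [NormedAddCommGroup E] [NormedSpace ℝ E]
    {W : E → E} {K L : NNReal} (hW : LipschitzWith K W) (hL : ∀ x, ‖W x‖ ≤ L) {f : ℝ → E}
    (hf : ∀ t, HasDerivAt f (W (f t)) t) {h : ℝ} (h0 : 0 ≤ h) :
    ‖f h - f 0‖ ≤ L * h ∧ ‖f h - f 0 - h • W (f 0)‖ ≤ K * L * h ^ 2 := by
  have h1 : ∀ r ∈ Set.Icc 0 h, ‖f r - f 0‖ ≤ L * (r - 0) :=
    norm_image_sub_le_of_norm_deriv_le_segment' (f' := fun r => W (f r))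
      (fun r _ => (hf r).hasDerivWithinAt) (fun r _ => hL _)
  refine ⟨by simpa using h1 h ⟨h0, le_rfl⟩, ?_⟩
  have h2 := norm_image_sub_le_of_norm_deriv_le_segment' (a := 0) (b := h) (C := K * (L * h))
    (f := fun r => f r - f 0 - r • W (f 0)) (f' := fun r => W (f r) - W (f 0))
    (fun r _ => ?_) (fun r hr => ?_) h ⟨h0, le_rfl⟩
  · simp only [sub_self, zero_smul, sub_zero] at h2
    exact h2.trans_eq (by ring)
  · have := ((hf r).sub_const (f 0)).fun_sub ((hasDerivAt_id' r).smul_const (W (f 0)))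
    rw [one_smul] at this
    exact this.hasDerivWithinAt
  · rw [← dist_eq_norm]
    refine (hW.dist_le_mul _ _).trans ?_
    gcongr
    rw [dist_eq_norm]
    refine (h1 r ⟨hr.1, hr.2.le⟩).trans ?_
    have := hr.2.le
    rw [sub_zero]
    gcongr

theorem dist_iterate_iterate_le {α : Type*} [PseudoMetricSpace α] {f g : α → α} {A δ : ℝ}
    (hA : 1 ≤ A) (hδ : 0 ≤ δ) (hf : ∀ x y, dist (f x) (f y) ≤ A * dist x y)
    (hfg : ∀ x, dist (f x) (g x) ≤ δ) (n : ℕ) (x : α) :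
    dist (f^[n] x) (g^[n] x) ≤ n * A ^ n * δ := by
  induction n with
  | zero => simp
  | succ n ih =>
    rw [Function.iterate_succ_apply', Function.iterate_succ_apply']
    have h1 := dist_triangle (f (f^[n] x)) (f (g^[n] x)) (g (g^[n] x))
    have h2 := (hf (f^[n] x) (g^[n] x)).trans
      (mul_le_mul_of_nonneg_left ih (by linarith : (0 : ℝ) ≤ A))
    have h3 := mul_le_mul_of_nonneg_right (one_le_pow₀ hA (n := n + 1)) hδ
    have h4 := hfg (g^[n] x)
    push_cast
    calc _ ≤ A * (n * A ^ n * δ) + δ := by linarith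
      _ ≤ A * (n * A ^ n * δ) + A ^ (n + 1) * δ := by linarith
      _ = _ := by ring

variable {ι : Type*} [Fintype ι] [DecidableEq ι]
  {S : ι → Type*} [∀ i, Fintype (S i)] [∀ i, DecidableEq (S i)]

theorem replicatorFlow_local_error (u : (∀ i, S i) → ι → ℝ) :
    ∃ C, 0 ≤ C ∧ ∀ (x : StrategySpace S) (h : ℝ), 0 ≤ h →
      ‖(replicatorFlow u h x).coords - x.coords‖ ≤ C * h ∧
      ‖(replicatorFlow u h x).coords - x.coords - h • truncatedField u x.coords‖ ≤ C * h ^ 2 := by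
  obtain ⟨K, L, hK, hL⟩ := truncatedField_lipschitz_bounded u
  refine ⟨max L (K * L), le_max_of_le_left L.2, fun x h h0 => ?_⟩
  have := norm_sub_sub_smul_le_of_hasDerivAt hK hL (fun t => replicatorFlow_hasDerivAt u x t) h0
  simp only [Flow.map_zero_apply] at this
  refine ⟨this.1.trans ?_, this.2.trans ?_⟩
  · gcongr
    exact le_max_left _ _
  · gcongr
    exact le_max_right _ _

theorem replicatorFlow_dist_le (u : (∀ i, S i) → ι → ℝ) :
    ∃ K : NNReal, ∀ (x y : StrategySpace S) (h : ℝ), 0 ≤ h →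
      dist (replicatorFlow u h x) (replicatorFlow u h y) ≤ Real.exp (K * h) * dist x y := by
  obtain ⟨K, L, hK, -⟩ := truncatedField_lipschitz_bounded u
  refine ⟨K, fun x y h h0 => ?_⟩
  have hx := replicatorFlow_hasDerivAt u x
  have hy := replicatorFlow_hasDerivAt u y
  have := dist_le_of_trajectories_ODE (v := fun _ => truncatedField u) (K := K)
    (a := 0) (b := h) (δ := dist x y) (fun _ => hK)
    (fun t _ => (hx t).continuousAt.continuousWithinAt)
    (fun t _ => (hx t).hasDerivWithinAt)
    (fun t _ => (hy t).continuousAt.continuousWithinAt)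
    (fun t _ => (hy t).hasDerivWithinAt)
    (by simp only [Flow.map_zero_apply]; exact le_rfl) h ⟨h0, le_rfl⟩
  rw [sub_zero, mul_comm] at this
  exact this

/-- The players of the list move one after the other, each for time `h`. -/
noncomputable def splitStep (u : (∀ i, S i) → ι → ℝ) (h : ℝ) : List ι → StrategySpace S →
    StrategySpace S
  | [], x => x
  | i :: l, x => splitStep u h l (playerStep u i h x)

theorem splitStep_local_error (u : (∀ i, S i) → ι → ℝ) (l : List ι) :
    ∃ C, 0 ≤ C ∧ ∀ (x : StrategySpace S) (h : ℝ), 0 ≤ h →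
      ‖(splitStep u h l x).coords - x.coords -
        h • (l.map fun i => truncatedField (maskUtility u i) x.coords).sum‖ ≤ C * h ^ 2 := by
  induction l with
  | nil => exact ⟨0, le_rfl, fun x h _ => by simp [splitStep]⟩
  | cons i l ih =>
    obtain ⟨C, hC, ih⟩ := ih
    obtain ⟨D, hD, hloc⟩ := replicatorFlow_local_error (maskUtility u i)
    obtain ⟨M, hM⟩ : ∃ M : NNReal, LipschitzWith M fun x : ∀ i, S i → ℝ =>
        (l.map fun i => truncatedField (maskUtility u i) x).sum := by
      clear ih
      induction l with
      | nil => exact ⟨0, by simp⟩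
      | cons j l ih =>
        obtain ⟨M, hM⟩ := ih
        obtain ⟨K, -, hK, -⟩ := truncatedField_lipschitz_bounded (maskUtility u j)
        exact ⟨K + M, by simpa using hK.add hM⟩
    refine ⟨C + M * D + D, by positivity, fun x h h0 => ?_⟩
    set x' := playerStep u i h x with hx'
    have h1 := hloc x h h0
    rw [replicatorFlow_maskUtility, ← hx'] at h1
    have h2 := ih x' h h0
    have h3 : ‖h • ((l.map fun i => truncatedField (maskUtility u i) x'.coords).sum -
        (l.map fun i => truncatedField (maskUtility u i) x.coords).sum)‖ ≤ h * (M * (D * h)) := by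
      rw [norm_smul, Real.norm_of_nonneg h0]
      gcongr
      rw [← dist_eq_norm]
      refine (hM.dist_le_mul _ _).trans ?_
      rw [dist_eq_norm]
      gcongr
      exact h1.1
    -- Three errors of order `h ^ 2`: that of the later moves started at `x'`, that of evaluating
    -- their fields at `x` instead of `x'`, and that of the first move.
    have h4 : (splitStep u h (i :: l) x).coords - x.coords -
        h • ((i :: l).map fun i => truncatedField (maskUtility u i) x.coords).sum =
        ((splitStep u h l x').coords - x'.coords -
          h • (l.map fun i => truncatedField (maskUtility u i) x'.coords).sum) +
        h • ((l.map fun i => truncatedField (maskUtility u i) x'.coords).sum -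
          (l.map fun i => truncatedField (maskUtility u i) x.coords).sum) +
        (x'.coords - x.coords - h • truncatedField (maskUtility u i) x.coords) := by
      simp only [splitStep, List.map_cons, List.sum_cons, ← hx']
      module
    rw [h4]
    refine (norm_add₃_le).trans ?_
    linarith [h1.2]

/-- Over a fixed time, the flow is uniformly approximated by iterated splitting steps. -/
theorem exists_splitStep_approx (u : (∀ i, S i) → ι → ℝ) {T ε : ℝ} (hT : 0 ≤ T) (hε : 0 < ε) :
    ∃ (h : ℝ) (n : ℕ), ∀ x : StrategySpace S,
      dist (replicatorFlow u T x) ((splitStep u h Finset.univ.toList)^[n] x) < ε := by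
  obtain ⟨C, hC, hsplit⟩ := splitStep_local_error u Finset.univ.toList
  obtain ⟨D, hD, hloc⟩ := replicatorFlow_local_error u
  obtain ⟨K, hK⟩ := replicatorFlow_dist_le u
  -- The `n` local errors `(C + D) * (T / n) ^ 2`, amplified by at most `exp (K * T)`, add up to a
  -- quantity of order `1 / n`.
  obtain ⟨n, hn⟩ := exists_nat_gt (Real.exp (K * T) * (C + D) * T ^ 2 / ε)
  have hn0 : (0 : ℝ) < n := lt_of_le_of_lt (by positivity) hn
  set h := T / n with hh
  have h0 : 0 ≤ h := by positivity
  have hnh : n * h = T := by rw [hh]; field_simp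
  refine ⟨h, n, fun x => ?_⟩
  have hiter : ∀ m : ℕ, (replicatorFlow u h)^[m] x = replicatorFlow u (m * h) x := by
    intro m
    induction m with
    | zero => simp
    | succ m ih =>
      rw [Function.iterate_succ_apply', ih, ← Flow.map_add]
      congr 1
      push_cast
      ring
  have hone : ∀ y : StrategySpace S, dist (replicatorFlow u h y)
      (splitStep u h Finset.univ.toList y) ≤ (C + D) * h ^ 2 := by
    intro y
    have h1 := hsplit y h h0
    have h2 := (hloc y h h0).2
    rw [Finset.sum_map_toList, sum_truncatedField_maskUtility] at h1
    rw [← StrategySpace.dist_coords, dist_eq_norm]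
    have h3 : (replicatorFlow u h y).coords - (splitStep u h Finset.univ.toList y).coords =
        ((replicatorFlow u h y).coords - y.coords - h • truncatedField u y.coords) -
        ((splitStep u h Finset.univ.toList y).coords - y.coords -
          h • truncatedField u y.coords) := by abel
    rw [h3]
    refine (norm_sub_le _ _).trans ?_
    linarith
  have key := dist_iterate_iterate_le (Real.one_le_exp (by positivity : 0 ≤ K * h))
    (by positivity : 0 ≤ (C + D) * h ^ 2) (fun x y => hK x y h h0) hone n x
  rw [hiter, hnh, ← Real.exp_nat_mul, mul_left_comm (n : ℝ) (K : ℝ) h, hnh] at key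
  refine key.trans_lt ?_
  rw [div_lt_iff₀ hε] at hn
  have : (n : ℝ) * Real.exp (K * T) * ((C + D) * h ^ 2) * n =
      Real.exp (K * T) * (C + D) * T ^ 2 := by
    rw [← hnh]; ring
  refine lt_of_mul_lt_mul_right ?_ hn0.le
  linarith

end Splitting

/-! ### Volume preservation in logarithmic coordinates -/

section Volume

open MeasureTheory

/-- Translating one coordinate by an amount that depends on the other coordinates preserves a
product of translation invariant measures. -/
theorem measurePreserving_update_add {ι : Type*} [Fintype ι] [DecidableEq ι] {E : ι → Type*}
    [∀ i, MeasurableSpace (E i)] [∀ i, AddGroup (E i)] [∀ i, MeasurableAdd₂ (E i)]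
    (μ : ∀ i, Measure (E i)) [∀ i, SigmaFinite (μ i)] (i : ι) [(μ i).IsAddRightInvariant]
    (c : (∀ j, E j) → E i) (hc : Measurable c) (hc' : ∀ y v, c (Function.update y i v) = c y) :
    MeasurePreserving (fun y => Function.update y i (y i + c y)) (Measure.pi μ)
      (Measure.pi μ) := by
  have hm : Measurable fun y : ∀ j, E j => Function.update y i (y i + c y) :=
    measurable_update'.comp (measurable_id.prodMk ((measurable_pi_apply i).add hc))
  refine ⟨hm, Measure.ext fun s hs => ?_⟩
  rw [Measure.map_apply hm hs, ← lintegral_indicator_one hs, ← lintegral_indicator_one (hm hs)]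
  -- Integrate over coordinate `i` first: on each fibre the map is a translation by a constant.
  refine lintegral_eq_of_lmarginal_eq {i} (measurable_const.indicator (hm hs))
    (measurable_const.indicator hs) ?_
  rw [lmarginal_singleton, lmarginal_singleton]
  funext y
  have : ∀ v, ((fun y : ∀ j, E j => Function.update y i (y i + c y)) ⁻¹' s).indicator
      (1 : (∀ j, E j) → ENNReal) (Function.update y i v) =
      s.indicator 1 (Function.update y i (v + c y)) := by
    intro v
    have hmem : Function.update y i v ∈ (fun y : ∀ j, E j => Function.update y i (y i + c y)) ⁻¹' s ↔
        Function.update y i (v + c y) ∈ s := by simp [hc']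
    by_cases hv : Function.update y i (v + c y) ∈ s
    · rw [Set.indicator_of_mem hv, Set.indicator_of_mem (hmem.2 hv)]
      rfl
    · rw [Set.indicator_of_notMem hv, Set.indicator_of_notMem (mt hmem.1 hv)]
  simp only [this]
  exact lintegral_add_right_eq_self (fun v => s.indicator 1 (Function.update y i v)) (c y)

/-- An open set of finite volume that is bounded above in one coordinate is not mapped by a
measure preserving map into its translates in the direction of that coordinate. -/
theorem eq_empty_of_measurePreserving_of_le {E : Type*} [TopologicalSpace E] [MeasurableSpace E]
    [OpensMeasurableSpace E] {μ : Measure E} [μ.IsOpenPosMeasure] {U : Set E} (hU : IsOpen U)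
    (hfin : μ U ≠ ⊤) {f : E → E} (hf : MeasurePreserving f μ μ) {e : E → ℝ} (he : Continuous e)
    (hb : BddAbove (e '' U)) {δ : ℝ} (hδ : 0 < δ) (hmaps : Set.MapsTo f U U)
    (hle : ∀ y ∈ U, ∃ w ∈ U, e w = e (f y) + δ) : U = ∅ := by
  by_contra! hne
  obtain ⟨_, ⟨y₀, hy₀, rfl⟩, hlt⟩ :=
    exists_lt_of_lt_csSup (hne.image e) (sub_lt_self (sSup (e '' U)) hδ)
  set c := sSup (e '' U) with hc
  have hVo : IsOpen (U ∩ {y | c - δ < e y}) := hU.inter (isOpen_lt continuous_const he)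
  have hpos : 0 < μ (U ∩ {y | c - δ < e y}) := hVo.measure_pos μ ⟨y₀, hy₀, hlt⟩
  -- Raising `f y` by `δ` still gives a height attained in `U`, so `f y` lies below the top layer of
  -- thickness `δ`.
  have hsub : U ⊆ f ⁻¹' (U \ {y | c - δ < e y}) := by
    intro y hy
    refine ⟨hmaps hy, fun h => ?_⟩
    obtain ⟨w, hw, hew⟩ := hle y hy
    have h1 := le_csSup hb ⟨w, hw, rfl⟩
    have h2 : c - δ < e (f y) := h
    rw [← hc] at h1
    linarith
  have hmV : MeasurableSet {y | c - δ < e y} := (isOpen_lt continuous_const he).measurableSet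
  have h1 : μ U ≤ μ (U \ {y | c - δ < e y}) := by
    rw [← hf.measure_preimage (hU.measurableSet.diff hmV).nullMeasurableSet]
    exact measure_mono hsub
  have h2 := measure_inter_add_sdiff (μ := μ) U hmV
  have h3 : μ (U \ {y | c - δ < e y}) < μ U := by
    conv_rhs => rw [← h2, add_comm]
    exact ENNReal.lt_add_right (ne_top_of_le_ne_top hfin (measure_mono Set.sdiff_subset)) hpos.ne'
  exact absurd h1 (not_le.2 h3)

variable {ι : Type*} [Fintype ι] [DecidableEq ι]
  {S : ι → Type*} [∀ i, Fintype (S i)] [∀ i, DecidableEq (S i)]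

open scoped Classical in
/-- The move of player `i` in logarithmic coordinates: the strategies in the support of `z` are
translated, the base strategy and the strategies outside the support stay put. -/
noncomputable def logShift (u : (∀ i, S i) → ι → ℝ) (z : StrategySpace S) (b : ∀ i, S i) (h : ℝ)
    (i : ι) (y : ∀ i, S i → ℝ) : S i → ℝ :=
  fun s => if z.coords i s = 0 then 0 else
    h * (deviationUtility u (tilt z y).coords i s - deviationUtility u (tilt z y).coords i (b i))

/-- The shear of the logarithmic coordinates that corresponds to a move of player `i`. -/
noncomputable def logStep (u : (∀ i, S i) → ι → ℝ) (z : StrategySpace S) (b : ∀ i, S i) (h : ℝ)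
    (i : ι) (y : ∀ i, S i → ℝ) : ∀ i, S i → ℝ :=
  Function.update y i (y i + logShift u z b h i y)

theorem continuous_logShift (u : (∀ i, S i) → ι → ℝ) (z : StrategySpace S) (b : ∀ i, S i) (h : ℝ)
    (i : ι) : Continuous (logShift u z b h i) := by
  have hd : ∀ s, Continuous fun y => deviationUtility u (tilt z y).coords i s := fun s =>
    (contDiff_deviationUtility u i s).continuous.comp (StrategySpace.continuous_coords.comp
      (continuous_tilt.comp (continuous_const.prodMk continuous_id)))
  refine continuous_pi fun s => ?_
  by_cases hs : z.coords i s = 0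
  · simp only [logShift, hs, if_true]
    exact continuous_const
  · simp only [logShift, hs, if_false]
    exact continuous_const.mul ((hd s).sub (hd (b i)))

theorem measurePreserving_logStep (u : (∀ i, S i) → ι → ℝ) (z : StrategySpace S) (b : ∀ i, S i)
    (h : ℝ) (i : ι) : MeasurePreserving (logStep u z b h i) := by
  refine measurePreserving_update_add (fun _ => volume) i (logShift u z b h i)
    (continuous_logShift u z b h i).measurable fun y v => ?_
  have key : ∀ s, deviationUtility u (tilt z (Function.update y i v)).coords i s =
      deviationUtility u (tilt z y).coords i s := fun s => deviationUtility_congr u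
    (fun j hj => congrArg Subtype.val (tilt_update_of_ne z y hj v)) s
  unfold logShift
  simp only [key]

/-- Subtracting the payoff of the base strategy changes the exponents by a constant, and zeroing the
shift off the support of `z` is invisible to `tilt z`. -/
theorem tilt_logStep (u : (∀ i, S i) → ι → ℝ) (z : StrategySpace S) (b : ∀ i, S i)
    (h : ℝ) (i : ι) (y : ∀ i, S i → ℝ) :
    tilt z (logStep u z b h i y) = playerStep u i h (tilt z y) := by
  rw [playerStep, tilt_tilt]
  funext j
  by_cases hj : j = i
  · subst hj
    refine tilt_congr (-(h * deviationUtility u (tilt z y).coords j (b j))) fun s hs => ?_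
    simp [logStep, logShift, hs]
    ring
  · exact tilt_congr 0 fun s hs => by simp [logStep, hj]

theorem logStep_apply_of (u : (∀ i, S i) → ι → ℝ) (z : StrategySpace S) (b : ∀ i, S i)
    (h : ℝ) (i : ι) (y : ∀ i, S i → ℝ) {j : ι} {s : S j} (hs : z.coords j s = 0 ∨ s = b j) :
    logStep u z b h i y j s = y j s := by
  by_cases hj : j = i
  · subst hj
    rcases hs with hs | rfl
    · simp [logStep, logShift, hs]
    · simp [logStep, logShift]
  · simp [logStep, hj]

/-- Iterated splitting steps are measure preserving in logarithmic coordinates. -/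
theorem exists_measurePreserving_splitStep (u : (∀ i, S i) → ι → ℝ) (z : StrategySpace S)
    (b : ∀ i, S i) (h : ℝ) (l : List ι) (n : ℕ) :
    ∃ f : (∀ i, S i → ℝ) → (∀ i, S i → ℝ), MeasurePreserving f ∧
      (∀ y, tilt z (f y) = (splitStep u h l)^[n] (tilt z y)) ∧
      ∀ y j s, z.coords j s = 0 ∨ s = b j → f y j s = y j s := by
  have hl : ∃ f : (∀ i, S i → ℝ) → (∀ i, S i → ℝ), MeasurePreserving f ∧
      (∀ y, tilt z (f y) = splitStep u h l (tilt z y)) ∧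
      ∀ y j s, z.coords j s = 0 ∨ s = b j → f y j s = y j s := by
    induction l with
    | nil => exact ⟨id, MeasurePreserving.id _, fun _ => rfl, fun _ _ _ _ => rfl⟩
    | cons i l ih =>
      obtain ⟨f, h1, h2, h3⟩ := ih
      refine ⟨f ∘ logStep u z b h i, h1.comp (measurePreserving_logStep u z b h i), fun y => ?_,
        fun y j s hs => ?_⟩
      · rw [Function.comp_apply, h2, tilt_logStep]
        rfl
      · rw [Function.comp_apply, h3 _ _ _ hs, logStep_apply_of u z b h i y hs]
  obtain ⟨f, h1, h2, h3⟩ := hl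
  refine ⟨f^[n], h1.iterate n, fun y => ?_, fun y j s hs => ?_⟩
  · exact (Function.Semiconj.iterate_right (f := tilt z) (ga := f) (gb := splitStep u h l) h2 n) y
  · induction n with
    | zero => rfl
    | succ n ih => rw [Function.iterate_succ_apply', h3 _ _ _ hs, ih]

end Volume

/-! ### Chains from any mixed profile to a pure profile -/

section Reachability

variable {α : Type*} [MetricSpace α] {φ : Flow ℝ α} {ε T : ℝ} {x : α}

/-- The last jump is bounded by a strict inequality, so its target may be moved slightly. -/
theorem isOpen_setOf_hasChain : IsOpen {y | HasChain φ ε T x y} := by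
  refine Metric.isOpen_iff.2 fun y hy => ?_
  obtain ⟨a, ha, t, ht, hd⟩ := Relation.TransGen.tail'_iff.1 (hasChain_iff_transGen.1 hy)
  refine ⟨ε - dist (φ t a) y, sub_pos.2 hd, fun w hw => hasChain_iff_transGen.2
    (Relation.TransGen.tail'_iff.2 ⟨a, ha, t, ht, ?_⟩)⟩
  rw [Metric.mem_ball, dist_comm] at hw
  linarith [dist_triangle (φ t a) y w]

theorem hasChain_of_mem_closure {w y : α} (hw : w ∈ closure {y | HasChain φ ε T x y})
    (hd : dist (φ T w) y < ε) : HasChain φ ε T x y := by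
  have hc : Continuous fun a => dist (φ T a) y := (φ.continuous_toFun T).dist continuous_const
  obtain ⟨a, ha, ha'⟩ := mem_closure_iff.1 hw _ (isOpen_lt hc continuous_const) hd
  exact HasChain.trans ha' (.single le_rfl ha)

end Reachability

section Pure

open MeasureTheory

variable {ι : Type*} {S : ι → Type*} [∀ i, Fintype (S i)]

theorem continuous_coords_apply (i : ι) (s : S i) :
    Continuous fun w : StrategySpace S => w.coords i s :=
  (continuous_apply s).comp (continuous_subtype_val.comp (continuous_apply i))

/-- Normalised logarithmic coordinates are bounded on the part of a compact set of profiles which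
lies in a face and does not meet the boundary of that face. -/
theorem exists_bound_of_tilt_mem {R : Set (StrategySpace S)} (hR : IsCompact R)
    {z : StrategySpace S} {b : ∀ i, S i} (hb : ∀ i, z.coords i (b i) ≠ 0)
    (hmin : ∀ w ∈ R, (∀ i s, z.coords i s = 0 → w.coords i s = 0) →
      ∀ i s, z.coords i s ≠ 0 → w.coords i s ≠ 0) :
    ∃ M : ∀ i, S i → ℝ, ∀ y : ∀ i, S i → ℝ, tilt z y ∈ R →
      (∀ i s, z.coords i s = 0 ∨ s = b i → y i s ∈ Set.Ioo (0 : ℝ) 1) → y ∈ Set.Icc (-M) M := by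
  have hK : IsCompact (R ∩ {w | ∀ i s, z.coords i s = 0 → w.coords i s = 0}) := by
    refine hR.inter_right ?_
    simp only [Set.ofPred_forall]
    exact isClosed_iInter fun i => isClosed_iInter fun s => isClosed_iInter fun _ =>
      isClosed_eq (continuous_coords_apply i s) continuous_const
  have hB : ∀ i s, ∃ B, z.coords i s ≠ 0 → ∀ w ∈ R,
      (∀ i s, z.coords i s = 0 → w.coords i s = 0) → |Real.log (w.coords i s)| ≤ B := by
    intro i s
    by_cases hs : z.coords i s = 0
    · exact ⟨0, fun h => absurd hs h⟩
    · obtain ⟨B, hB⟩ := hK.exists_bound_of_continuousOn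
        (f := fun w : StrategySpace S => Real.log (w.coords i s))
        ((continuous_coords_apply i s).continuousOn.log fun w hw => hmin w hw.1 hw.2 i s hs)
      exact ⟨B, fun _ w hw hw' => hB w ⟨hw, hw'⟩⟩
  choose B hB using hB
  have hM : ∀ i s, ∃ M, ∀ y : ∀ i, S i → ℝ, tilt z y ∈ R →
      (∀ i s, z.coords i s = 0 ∨ s = b i → y i s ∈ Set.Ioo (0 : ℝ) 1) → |y i s| ≤ M := by
    intro i s
    by_cases hs : z.coords i s = 0
    · refine ⟨1, fun y _ hy => ?_⟩
      have := hy i s (.inl hs)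
      exact abs_le.2 ⟨by linarith [this.1], this.2.le⟩
    -- For `w = tilt z y`, log-ratios to the base strategy eliminate the partition function: `y i s
    -- - y i (b i)` equals `log (w i s / w i (b i)) - log (z i s / z i (b i))`, and `y i (b i)` lies
    -- in `(0, 1)`.
    refine ⟨1 + B i s + B i (b i) + |Real.log (z.coords i s)| + |Real.log (z.coords i (b i))|,
      fun y hyR hy => ?_⟩
    have hsupp : ∀ i s, z.coords i s = 0 → (tilt z y).coords i s = 0 :=
      fun i s h => tilt_coords_eq_zero.2 h
    have hlog : ∀ s, z.coords i s ≠ 0 → Real.log ((tilt z y).coords i s) =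
        Real.log (z.coords i s) + y i s - Real.log (partition z y i) := by
      intro s hs
      rw [tilt_coords, Real.log_div (mul_ne_zero hs (Real.exp_ne_zero _)) (partition_pos z y i).ne',
        Real.log_mul hs (Real.exp_ne_zero _), Real.log_exp]
    have h1 := hlog s hs
    have h2 := hlog _ (hb i)
    have h3 := abs_le.1 (hB i s hs _ hyR hsupp)
    have h4 := abs_le.1 (hB i _ (hb i) _ hyR hsupp)
    have h5 := hy i _ (.inr rfl)
    have h6 := abs_le.1 (le_refl |Real.log (z.coords i s)|)
    have h7 := abs_le.1 (le_refl |Real.log (z.coords i (b i))|)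
    exact abs_le.2 ⟨by linarith [h5.1], by linarith [h5.2]⟩
  choose M hM using hM
  exact ⟨M, fun y hyR hy => ⟨fun i s => (abs_le.1 (hM i s y hyR hy)).1,
    fun i s => (abs_le.1 (hM i s y hyR hy)).2⟩⟩

variable [Fintype ι]

/-- A nonempty set of mixed profiles has a member whose support contains no support of another
member strictly. -/
theorem exists_minimal_support {R : Set (StrategySpace S)} (hR : R.Nonempty) :
    ∃ z ∈ R, ∀ w ∈ R, (∀ i s, z.coords i s = 0 → w.coords i s = 0) →
      ∀ i s, z.coords i s ≠ 0 → w.coords i s ≠ 0 := by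
  classical
  let supp : StrategySpace S → Finset (Σ i, S i) := fun w =>
    Finset.univ.filter fun p => w.coords p.1 p.2 ≠ 0
  obtain ⟨z, hz, hmin⟩ := (InvImage.wf (fun w => (supp w).card) Nat.lt_wfRel.wf).has_min R hR
  refine ⟨z, hz, fun w hw hle i s hs hs' => hmin w hw (Finset.card_lt_card ?_)⟩
  refine Finset.ssubset_iff_subset_ne.2 ⟨fun p hp => ?_, fun heq => ?_⟩
  · simp only [supp, Finset.mem_filter, Finset.mem_univ, true_and] at hp ⊢
    exact fun h => hp (hle _ _ h)
  · have : (⟨i, s⟩ : Σ i, S i) ∈ supp w := by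
      rw [heq]
      simpa [supp] using hs
    simp only [supp, Finset.mem_filter, Finset.mem_univ, true_and] at this
    exact this hs'

/-- The tilt is the identity at `δ = 0`; compactness of the strategy space makes the smallness
uniform in `x`. -/
theorem exists_tilt_dist_lt (g : ∀ i, S i → ℝ) {ε : ℝ} (hε : 0 < ε) :
    ∃ δ : ℝ, 0 < δ ∧ ∀ x : StrategySpace S, dist x (tilt x (δ • g)) < ε := by
  have hc : Continuous fun p : ℝ × StrategySpace S => dist p.2 (tilt p.2 (p.1 • g)) :=
    continuous_snd.dist (continuous_tilt.comp
      (continuous_snd.prodMk (continuous_fst.smul continuous_const)))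
  have hev : ∀ᶠ δ in nhds (0 : ℝ), ∀ x ∈ (Set.univ : Set (StrategySpace S)),
      dist x (tilt x (δ • g)) < ε := by
    refine isCompact_univ.eventually_forall_of_forall_eventually fun x _ => ?_
    refine (hc.tendsto (0, x)).eventually (gt_mem_nhds ?_)
    simpa [tilt_zero] using hε
  obtain ⟨δ, hδ, hδ0⟩ := ((hev.filter_mono nhdsWithin_le_nhds).and
    (self_mem_nhdsWithin : Set.Ioi (0 : ℝ) ∈ nhdsWithin 0 (Set.Ioi 0))).exists
  exact ⟨δ, hδ0, fun x => hδ x trivial⟩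

variable [DecidableEq ι] [∀ i, DecidableEq (S i)]

theorem exists_pureProfile_hasChain (u : (∀ i, S i) → ι → ℝ) (x : StrategySpace S) {ε T : ℝ}
    (hε : 0 < ε) (hT : 0 < T) :
    ∃ q : ∀ i, S i, HasChain (replicatorFlow u) ε T x (pureProfile q) := by
  set φ := replicatorFlow u
  set R := {y | HasChain φ ε T x y} with hR
  have hRo : IsOpen R := isOpen_setOf_hasChain
  have hne : (closure R).Nonempty :=
    ⟨φ T x, subset_closure (HasChain.single le_rfl (by rwa [dist_self]))⟩
  obtain ⟨z, hz, hmin⟩ := exists_minimal_support hne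
  choose b hb using z.exists_coords_pos
  by_cases hpure : ∀ i s, z.coords i s ≠ 0 → s = b i
  · have hzb : z = pureProfile b := by
      refine StrategySpace.ext_coords fun i s => ?_
      have hval : ∀ s, s ≠ b i → z.coords i s = 0 := fun s hs => by
        by_contra h
        exact hs (hpure i s h)
      have hone := z.sum_coords i
      rw [Finset.sum_eq_single (b i) (fun s _ => hval s) (by simp)] at hone
      change z.coords i s = (Pi.single (b i) 1 : S i → ℝ) s
      by_cases hs : s = b i
      · subst hs; simpa using hone
      · simpa [hs] using hval s hs
    refine ⟨b, hasChain_of_mem_closure (hzb ▸ hz) ?_⟩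
    rw [replicatorFlow_pureProfile, dist_self]
    exact hε
  exfalso
  push Not at hpure
  obtain ⟨i₀, s₀, hs₀, hsb⟩ := hpure
  obtain ⟨M, hM⟩ := exists_bound_of_tilt_mem (R := closure R) (z := z) (b := b)
    isClosed_closure.isCompact (fun i => (hb i).ne') hmin
  obtain ⟨h, n, happrox⟩ := exists_splitStep_approx u hT.le (half_pos hε)
  obtain ⟨f, hf, hfz, hfix⟩ :=
    exists_measurePreserving_splitStep u z b h Finset.univ.toList n
  -- The direction of the extra push: a supported strategy other than the base one, hence a genuine
  -- coordinate of the face. Half of `ε` pays for this push, half for the splitting.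
  let g : ∀ i, S i → ℝ := Pi.single i₀ (Pi.single s₀ 1)
  obtain ⟨δ, hδ, hg⟩ := exists_tilt_dist_lt g (half_pos hε)
  have hgfix : ∀ j s, z.coords j s = 0 ∨ s = b j → g j s = 0 := by
    intro j s hs
    by_cases hj : j = i₀
    · subst hj
      have : s ≠ s₀ := by
        rintro rfl
        exact hs.elim hs₀ hsb
      simp [g, this]
    · simp [g, hj]
  -- Base and unsupported coordinates are dummies, fixed by `f` and confined to `(0, 1)`. They make
  -- `U` open and bounded in the full space, so ambient Lebesgue measure can be used.
  let U : Set (∀ i, S i → ℝ) :=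
    {y | (∀ i s, z.coords i s = 0 ∨ s = b i → y i s ∈ Set.Ioo (0 : ℝ) 1) ∧ tilt z y ∈ R}
  have hyc : ∀ i s, Continuous fun y : ∀ i, S i → ℝ => y i s :=
    fun i s => (continuous_apply s).comp (continuous_apply i)
  have hUo : IsOpen U := by
    refine IsOpen.and ?_
      (hRo.preimage (continuous_tilt.comp (continuous_const.prodMk continuous_id)))
    simp only [Set.ofPred_forall]
    exact isOpen_iInter_of_finite fun i => isOpen_iInter_of_finite fun s =>
      isOpen_iInter_of_finite fun _ => isOpen_Ioo.preimage (hyc i s)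
  have hUM : U ⊆ Set.Icc (-M) M := fun y hy => hM y (subset_closure hy.2) hy.1
  -- Stated for `closure R`, since `z`, which shows that `U` is nonempty, is only known to lie in
  -- the closure.
  have hbox : ∀ y : ∀ i, S i → ℝ,
      (∀ i s, z.coords i s = 0 ∨ s = b i → y i s ∈ Set.Ioo (0 : ℝ) 1) →
      tilt z y ∈ closure R → f y ∈ U ∧ f y + δ • g ∈ U := by
    intro y hy hyR
    have h1 := happrox (tilt z y)
    rw [← hfz] at h1
    refine ⟨⟨fun i s hs => ?_, hasChain_of_mem_closure hyR (h1.trans (half_lt_self hε))⟩,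
      fun i s hs => ?_, hasChain_of_mem_closure hyR ?_⟩
    · rw [hfix y i s hs]
      exact hy i s hs
    · rw [Pi.add_apply, Pi.add_apply, Pi.smul_apply, Pi.smul_apply, hgfix i s hs, smul_zero,
        add_zero, hfix y i s hs]
      exact hy i s hs
    · rw [← tilt_tilt]
      have h2 := hg (tilt z (f y))
      linarith [dist_triangle (φ T (tilt z y)) (tilt z (f y)) (tilt (tilt z (f y)) (δ • g))]
  have hempty : U = ∅ := by
    refine eq_empty_of_measurePreserving_of_le (μ := volume) (f := f) (e := fun y => y i₀ s₀)
      (δ := δ) hUo (ne_top_of_le_ne_top isCompact_Icc.measure_lt_top.ne (measure_mono hUM)) hf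
      (hyc i₀ s₀) ⟨M i₀ s₀, ?_⟩ hδ (fun y hy => (hbox y hy.1 (subset_closure hy.2)).1)
      fun y hy => ⟨_, (hbox y hy.1 (subset_closure hy.2)).2, ?_⟩
    · rintro _ ⟨y, hy, rfl⟩
      exact (hUM hy).2 i₀ s₀
    · simp [g]
  have hconst : tilt z (fun _ _ => 1 / 2) = z := funext fun i => tilt_const (1 / 2) fun _ _ => rfl
  have hstart := hbox (fun _ _ => 1 / 2) (fun _ _ _ => by norm_num) (by rwa [hconst])
  rw [hempty] at hstart
  exact hstart.1

/-- Every mixed profile has a pseudo-orbit to a pure profile. -/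
theorem exists_pureProfile_hasPseudoOrbit (u : (∀ i, S i) → ι → ℝ) (x : StrategySpace S) :
    ∃ q : ∀ i, S i, HasPseudoOrbit (replicatorFlow u) x (pureProfile q) :=
  exists_hasPseudoOrbit_of_finite pureProfile fun _ hε _ hT =>
    exists_pureProfile_hasChain u x hε hT

end Pure

/-! ### Arcs of the response graph are pseudo-orbits -/

section Arcs

variable {ι : Type*} [DecidableEq ι]
  {S : ι → Type*} [∀ i, Fintype (S i)] [∀ i, DecidableEq (S i)]

/-- The profile in which player `i` plays `b` with probability `r` and `p i` otherwise, while the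
other players play `p`. -/
noncomputable def edgeProfile (p : ∀ i, S i) (i : ι) (b : S i) (r : Set.Icc (0 : ℝ) 1) :
    StrategySpace S :=
  Function.update (pureProfile p) i ⟨(1 - r.1) • Pi.single (p i) 1 + r.1 • Pi.single b 1,
    convex_stdSimplex ℝ (S i) (single_mem_stdSimplex ℝ (p i)) (single_mem_stdSimplex ℝ b)
      (sub_nonneg.2 r.2.2) r.2.1 (sub_add_cancel _ _)⟩

variable {p : ∀ i, S i} {i : ι} {b : S i}

theorem edgeProfile_of_ne {j : ι} (hj : j ≠ i) (r : Set.Icc (0 : ℝ) 1) :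
    edgeProfile p i b r j = pureProfile p j := by
  simp [edgeProfile, hj]

theorem edgeProfile_coords (r : Set.Icc (0 : ℝ) 1) (s : S i) :
    (edgeProfile p i b r).coords i s =
      (if s = p i then 1 - r.1 else 0) + if s = b then r.1 else 0 := by
  simp [edgeProfile, StrategySpace.coords, Pi.single_apply]

theorem edgeProfile_zero : edgeProfile p i b ⟨0, by simp⟩ = pureProfile p := by
  funext j
  by_cases hj : j = i
  · subst hj
    refine Subtype.ext (funext fun s => (edgeProfile_coords _ s).trans ?_)
    simp [pureProfile, Pi.single_apply]
  · exact edgeProfile_of_ne hj _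

theorem edgeProfile_one : edgeProfile p i b ⟨1, by simp⟩ = pureProfile (Function.update p i b) := by
  funext j
  by_cases hj : j = i
  · subst hj
    refine Subtype.ext (funext fun s => (edgeProfile_coords _ s).trans ?_)
    simp [pureProfile, Pi.single_apply]
  · rw [edgeProfile_of_ne hj]
    simp [pureProfile, hj]

variable [Fintype ι]

theorem dist_edgeProfile_le (hb : b ≠ p i) (r r' : Set.Icc (0 : ℝ) 1) :
    dist (edgeProfile p i b r) (edgeProfile p i b r') ≤ |r.1 - r'.1| := by
  refine (dist_pi_le_iff (abs_nonneg _)).2 fun j => ?_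
  by_cases hj : j = i
  · subst hj
    refine (dist_pi_le_iff (abs_nonneg _)).2 fun s => ?_
    change dist ((edgeProfile p j b r).coords j s) ((edgeProfile p j b r').coords j s) ≤ _
    rw [edgeProfile_coords, edgeProfile_coords, Real.dist_eq]
    by_cases h1 : s = p j
    · subst h1
      rw [if_pos rfl, if_neg hb.symm, if_pos rfl, if_neg hb.symm, abs_sub_comm]
      exact le_of_eq (by congr 1; ring)
    · rw [if_neg h1, if_neg h1]
      split_ifs <;> simp
  · rw [edgeProfile_of_ne hj, edgeProfile_of_ne hj, dist_self]
    exact abs_nonneg _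

theorem expectedUtility_pureProfile (u : (∀ i, S i) → ι → ℝ) (q : ∀ i, S i) (i : ι) :
    expectedUtility u (pureProfile q).coords i = u q i := by
  have hc : ∀ j s, (pureProfile q).coords j s = if s = q j then 1 else 0 :=
    fun j s => Pi.single_apply _ _ _
  unfold expectedUtility
  rw [Finset.sum_eq_single q]
  · simp [hc]
  · intro q' _ hq'
    obtain ⟨j, hj⟩ := Function.ne_iff.1 hq'
    rw [Finset.prod_eq_zero (Finset.mem_univ j) (by rw [hc, if_neg hj]), mul_zero]
  · simp

theorem deviationUtility_edgeProfile (u : (∀ i, S i) → ι → ℝ) (r : Set.Icc (0 : ℝ) 1) (s : S i) :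
    deviationUtility u (edgeProfile p i b r).coords i s = u (Function.update p i s) i := by
  rw [← expectedUtility_pureProfile u (Function.update p i s) i]
  unfold deviationUtility
  congr 1
  funext j
  by_cases hj : j = i
  · subst hj
    funext a
    simp [StrategySpace.coords, pureProfile]
  · funext a
    simp [StrategySpace.coords, pureProfile, edgeProfile_of_ne hj, hj]

/-- On an edge, the share of the better reply does not decrease. -/
theorem exists_replicatorFlow_edgeProfile (u : (∀ i, S i) → ι → ℝ) (hb : b ≠ p i)
    (hu : u p i ≤ u (Function.update p i b) i) (r : Set.Icc (0 : ℝ) 1) {t : ℝ} (ht : 0 ≤ t) :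
    ∃ r' : Set.Icc (0 : ℝ) 1, r.1 ≤ r'.1 ∧
      replicatorFlow u t (edgeProfile p i b r) = edgeProfile p i b r' := by
  rw [replicatorFlow_eq_playerStep u i]
  swap
  · intro t j hj s
    refine replicatorField_eq_zero_of_pure u (a := p j) ?_ s
    exact congrArg Subtype.val ((playerStep_of_ne u hj t _).trans (edgeProfile_of_ne hj r))
  set x := edgeProfile p i b r with hx
  set y := playerStep u i t x with hy
  have hy0 : ∀ s, s ≠ p i → s ≠ b → y.coords i s = 0 := fun s h1 h2 =>
    tilt_coords_eq_zero.2 (by rw [hx, edgeProfile_coords, if_neg h1, if_neg h2, add_zero])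
  have hsum : y.coords i (p i) + y.coords i b = 1 := by
    rw [← y.sum_coords i, ← Finset.sum_pair (f := y.coords i) hb.symm]
    refine Finset.sum_subset (Finset.subset_univ _) fun s _ hs => ?_
    simp only [Finset.mem_insert, Finset.mem_singleton, not_or] at hs
    exact hy0 s hs.1 hs.2
  refine ⟨⟨y.coords i b, y.coords_nonneg i b, y.coords_le_one i b⟩, ?_, ?_⟩
  · change r.1 ≤ y.coords i b
    set G : ∀ j, S j → ℝ := Pi.single i fun s => t * deviationUtility u x.coords i s with hG
    have hxb : x.coords i b = r.1 := by
      rw [hx, edgeProfile_coords, if_neg hb, if_pos rfl, zero_add]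
    -- The partition function is an average of exponentials, and `b` has the largest exponent on the
    -- support.
    have hle : partition x G i ≤ Real.exp (G i b) := by
      have : ∀ s, x.coords i s * Real.exp (G i s) ≤ x.coords i s * Real.exp (G i b) := by
        intro s
        by_cases h1 : s = b
        · rw [h1]
        by_cases h2 : s = p i
        · refine mul_le_mul_of_nonneg_left (Real.exp_le_exp.2 ?_) (x.coords_nonneg i s)
          simp only [hG, Pi.single_eq_same]
          rw [hx, deviationUtility_edgeProfile, deviationUtility_edgeProfile, h2,
            Function.update_eq_self]
          exact mul_le_mul_of_nonneg_left hu ht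
        · rw [hx, edgeProfile_coords, if_neg h1, if_neg h2]
          simp
      refine (Finset.sum_le_sum fun s _ => this s).trans ?_
      rw [← Finset.sum_mul, x.sum_coords, one_mul]
    change r.1 ≤ x.coords i b * Real.exp (G i b) / partition x G i
    rw [le_div_iff₀ (partition_pos x G i), hxb]
    exact mul_le_mul_of_nonneg_left hle r.2.1
  · funext j
    by_cases hj : j = i
    · subst hj
      refine Subtype.ext (funext fun s => Eq.trans ?_ (edgeProfile_coords _ s).symm)
      change y.coords j s = _
      by_cases h1 : s = p j
      · subst h1
        rw [if_pos rfl, if_neg hb.symm]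
        linarith
      by_cases h2 : s = b
      · subst h2
        rw [if_neg h1, if_pos rfl, zero_add]
      · rw [hy0 s h1 h2, if_neg h1, if_neg h2, add_zero]
    · rw [hy, playerStep_of_ne u hj, hx, edgeProfile_of_ne hj, edgeProfile_of_ne hj]

/-- Flow for time `T`, then jump by at most `ε / 2` towards `b`. The flow loses no ground, even
under indifference, so finitely many jumps suffice. -/
theorem hasPseudoOrbit_update (u : (∀ i, S i) → ι → ℝ) (hb : b ≠ p i)
    (hu : u p i ≤ u (Function.update p i b) i) :
    HasPseudoOrbit (replicatorFlow u) (pureProfile p) (pureProfile (Function.update p i b)) := by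
  intro ε hε T hT
  have key : ∀ (k : ℕ) (r : Set.Icc (0 : ℝ) 1), 1 - r.1 ≤ k * (ε / 2) →
      HasChain (replicatorFlow u) ε T (edgeProfile p i b r) (edgeProfile p i b ⟨1, by simp⟩) := by
    intro k
    induction k with
    | zero =>
      intro r hr
      -- Here `r = 1` already, but a chain needs at least one step: remain at the endpoint.
      obtain ⟨r', hr', he⟩ := exists_replicatorFlow_edgeProfile u hb hu r hT.le
      have h1 : r' = ⟨1, by simp⟩ := Subtype.ext (le_antisymm r'.2.2 (by
        simp only [Nat.cast_zero, zero_mul] at hr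
        linarith))
      exact .single le_rfl (by rw [he, h1, dist_self]; exact hε)
    | succ k ih =>
      intro r hr
      obtain ⟨r', hr', he⟩ := exists_replicatorFlow_edgeProfile u hb hu r hT.le
      have h0 := r'.2.1
      have hmin : r'.1 ≤ min 1 (r'.1 + ε / 2) := le_min r'.2.2 (by linarith)
      refine HasChain.trans (.single (t := T) le_rfl ?_)
        (ih ⟨min 1 (r'.1 + ε / 2), h0.trans hmin, min_le_left _ _⟩ ?_)
      · rw [he]
        refine (dist_edgeProfile_le hb _ _).trans_lt ?_
        rw [abs_sub_comm, abs_of_nonneg (sub_nonneg.2 hmin)]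
        linarith [min_le_right 1 (r'.1 + ε / 2)]
      · push_cast at hr
        change 1 - min 1 (r'.1 + ε / 2) ≤ _
        rcases min_choice 1 (r'.1 + ε / 2) with h | h <;> rw [h]
        · rw [sub_self]
          positivity
        · linarith
  obtain ⟨k, hk⟩ := exists_nat_gt (1 / (ε / 2))
  have h := key k ⟨0, by simp⟩ (by
    rw [div_lt_iff₀ (half_pos hε)] at hk
    simpa using hk.le)
  rwa [edgeProfile_zero, edgeProfile_one] at h

theorem hasPseudoOrbit_pureProfile_self (u : (∀ i, S i) → ι → ℝ) (q : ∀ i, S i) :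
    HasPseudoOrbit (replicatorFlow u) (pureProfile q) (pureProfile q) :=
  .of_fixed fun t => replicatorFlow_pureProfile u q t

theorem hasPseudoOrbit_of_path (u : (∀ i, S i) → ι → ℝ) {p q : ∀ i, S i}
    (h : Relation.ReflTransGen (responseGraph u).Adj p q) :
    HasPseudoOrbit (replicatorFlow u) (pureProfile p) (pureProfile q) := by
  induction h with
  | refl => exact hasPseudoOrbit_pureProfile_self u p
  | @tail q r _ hqr ih =>
    obtain ⟨i, hi, hne, hu⟩ := hqr
    have hr : r = Function.update q i (r i) := Function.eq_update_iff.2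
      ⟨rfl, fun j hj => (hne j hj).symm⟩
    rw [hr]
    exact ih.trans (hasPseudoOrbit_update u hi.symm (by rwa [← hr]))

end Arcs

/-! ### Sink connected components of finite directed graphs -/

section SinkComponents

variable {V : Type*} {G : Digraph V}

theorem Digraph.isAttracting_setOf_path (p : V) :
    G.IsAttracting {q | Relation.ReflTransGen G.Adj p q} :=
  fun _ hq _ h => Relation.ReflTransGen.trans hq h

/-- The nodes reachable from `p` form an attracting subset of `H`, which by minimality is all of
`H`. -/
theorem Digraph.IsSinkConnectedComponent.path {H : Set V} (hH : G.IsSinkConnectedComponent H)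
    {p q : V} (hp : p ∈ H) (hq : q ∈ H) : Relation.ReflTransGen G.Adj p q :=
  hH.le_of_le ⟨⟨p, .refl⟩, isAttracting_setOf_path p⟩ (fun r hr => hH.prop.2 p hp r hr) hq

theorem Digraph.exists_isSinkConnectedComponent [Finite V] (G : Digraph V) (p : V) :
    ∃ H, G.IsSinkConnectedComponent H ∧ ∃ q ∈ H, Relation.ReflTransGen G.Adj p q := by
  obtain ⟨H, hle, hH⟩ := (Set.toFinite {W : Set V | W.Nonempty ∧ G.IsAttracting W}).exists_le_minimal
    (a := {q | Relation.ReflTransGen G.Adj p q}) ⟨⟨p, .refl⟩, isAttracting_setOf_path p⟩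
  obtain ⟨q, hq⟩ := hH.prop.1
  exact ⟨H, hH, q, hq, hle hq⟩

end SinkComponents

/-! ### Existence of sink chain components -/

section Main

variable {ι : Type*} [Fintype ι] [DecidableEq ι]
  {S : ι → Type*} [∀ i, Fintype (S i)] [∀ i, DecidableEq (S i)]

/-- Every mixed profile has a pseudo-orbit to a pure profile from which every pseudo-orbit can be
reversed. -/
theorem exists_terminal_pureProfile (u : (∀ i, S i) → ι → ℝ) (x : StrategySpace S) :
    ∃ p : ∀ i, S i, HasPseudoOrbit (replicatorFlow u) x (pureProfile p) ∧
      ∀ w, HasPseudoOrbit (replicatorFlow u) (pureProfile p) w →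
        HasPseudoOrbit (replicatorFlow u) w (pureProfile p) := by
  -- An auxiliary graph whose arcs are all pseudo-orbits between pure profiles, not only responses;
  -- its sink components yield terminal profiles.
  let G : Digraph (∀ i, S i) :=
    ⟨fun p q => HasPseudoOrbit (replicatorFlow u) (pureProfile p) (pureProfile q)⟩
  have hG : ∀ p q, Relation.ReflTransGen G.Adj p q →
      HasPseudoOrbit (replicatorFlow u) (pureProfile p) (pureProfile q) := by
    intro p q h
    induction h with
    | refl => exact hasPseudoOrbit_pureProfile_self u p
    | tail _ h ih => exact ih.trans h
  obtain ⟨q, hq⟩ := exists_pureProfile_hasPseudoOrbit u x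
  obtain ⟨H, hH, p, hp, hqp⟩ := G.exists_isSinkConnectedComponent q
  refine ⟨p, hq.trans (hG q p hqp), fun w hw => ?_⟩
  obtain ⟨r, hr⟩ := exists_pureProfile_hasPseudoOrbit u w
  have hrH : r ∈ H := hH.prop.2 p hp r (.single (hw.trans hr))
  exact hr.trans (hG r p (hH.path hrH hp))

theorem exists_isSinkChainComponent_of_profile (u : (∀ i, S i) → ι → ℝ) (x : StrategySpace S) :
    ∃ (y : ∀ i, S i) (H : Set (∀ i, S i)) (C : Set (StrategySpace S)),
      HasPseudoOrbit (replicatorFlow u) x (pureProfile y) ∧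
      (responseGraph u).IsSinkConnectedComponent H ∧ y ∈ H ∧
      IsSinkChainComponent (replicatorFlow u) C ∧ pureProfile '' H ⊆ C := by
  obtain ⟨p, hxp, hp⟩ := exists_terminal_pureProfile u x
  obtain ⟨H, hH, y, hy, hpath⟩ := (responseGraph u).exists_isSinkConnectedComponent p
  have hpy := hasPseudoOrbit_of_path u hpath
  have hrec : IsChainRecurrent (replicatorFlow u) (pureProfile y) :=
    ⟨hasPseudoOrbit_pureProfile_self u y, hasPseudoOrbit_pureProfile_self u y⟩
  refine ⟨y, H, _, hxp.trans hpy, hH, hy, ⟨⟨_, hrec, rfl⟩, ?_⟩, ?_⟩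
  · rintro D hD ⟨a, ha, w, hw, haw⟩
    have hyw : HasPseudoOrbit (replicatorFlow u) (pureProfile y) w := ha.1.trans haw
    -- The terminal profile `p` reaches `w` through `y`, so `w` returns to `p` and thence to `y`.
    have hwy := (hp w (hpy.trans hyw)).trans hpy
    obtain ⟨-, rfl⟩ := hD.eq_of_mem hw
    exact Set.ext fun v => ⟨ChainEquivalent.trans ⟨hyw, hwy⟩, ChainEquivalent.trans ⟨hwy, hyw⟩⟩
  · rintro _ ⟨q, hq, rfl⟩
    exact ⟨hasPseudoOrbit_of_path u (hH.path hy hq), hasPseudoOrbit_of_path u (hH.path hq hy)⟩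

end Main

theorem mainTheorem1 {ι : Type*} [Fintype ι] [DecidableEq ι]
    {S : ι → Type*} [∀ i, Fintype (S i)] [∀ i, DecidableEq (S i)] [∀ i, Nonempty (S i)]
    (u : (∀ i, S i) → ι → ℝ) :
    (∀ x : StrategySpace S, IsChainRecurrent (replicatorFlow u) x →
      ∃ (y : ∀ i, S i) (H : Set (∀ i, S i)) (C : Set (StrategySpace S)),
        HasPseudoOrbit (replicatorFlow u) x (pureProfile y) ∧
        (responseGraph u).IsSinkConnectedComponent H ∧ y ∈ H ∧
        IsSinkChainComponent (replicatorFlow u) C ∧ pureProfile '' H ⊆ C) ∧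
    (∃ C : Set (StrategySpace S), IsSinkChainComponent (replicatorFlow u) C) ∧
    (∀ C : Set (StrategySpace S), IsSinkChainComponent (replicatorFlow u) C →
      ∃ H : Set (∀ i, S i), (responseGraph u).IsSinkConnectedComponent H ∧
        pureProfile '' H ⊆ C) := by
  refine ⟨fun x _ => exists_isSinkChainComponent_of_profile u x, ?_, fun C hC => ?_⟩
  · obtain ⟨-, -, C, -, -, -, hC, -⟩ := exists_isSinkChainComponent_of_profile u
      (pureProfile fun i => Classical.arbitrary (S i))
    exact ⟨C, hC⟩
  · obtain ⟨x, hx, hCx⟩ := hC.1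
    obtain ⟨y, H, C', hxy, hH, hy, hC', hHC'⟩ := exists_isSinkChainComponent_of_profile u x
    have hxC : x ∈ C := by
      rw [hCx]
      exact hx
    -- A sink component cannot be left, so the component reached from its own point `x` is `C`
    -- itself.
    have : C' = C := hC.2 C' hC'.1 ⟨x, hxC, _, hHC' ⟨y, hy, rfl⟩, hxy⟩
    exact ⟨H, hH, this ▸ hHC'⟩
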